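/- Let $R$ be a finite commutative chain ring (its ideals are totally ordered by inclusion) with maximal ideal $\langle\pi\rangle$, residue field $R/\langle\pi\rangle$ of size $q$, and chain length $s$ (the smallest positive integer with $\pi^s=0$). An $s$-shape is a sequence of integers $0\le\mu_1\le\dots\le\mu_s$; put $|\mu|=\sum_i\mu_i$, $\mu_0=0$, $m=\mu_s$, and $$R^\mu=\prod_{i=1}^{s}\langle\pi^{i-1}\rangle^{\mu_i-\mu_{i-1}}\subseteq R^{m}.$$ Let $R^{n\times\mu}$ be the set of $n\times m$ matrices over $R$ all of whose rows lie in $R^\mu$. A matrix $A\in R^{N\times n}$ has full column rank if the row span of $A^T$ is isomorphic, as an $R$-module, to $R^n$. For $N\ge n$, the multiplicative matrix channel (MMC) has input $X\in R^{n\times\mu}$ and output $Y=AX\in R^{N\times\mu}$, where $A$ is independent of $X$ and uniformly distributed over the full-column-rank matrices in $R^{N\times n}$. Its capacity is $C_{\mathrm{MMC}}=\max_{p_X}I(X;Y)$, the maximum being over all distributions of $X$ on $R^{n\times\mu}$ and the mutual information being measured with logarithms to the base $q$. **Bounds.** For all integers $0\le n\le N$ and every $s$-shape $\mu$, the maximum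 exists and, with $\kappa_i=\min\{n,\lfloor\mu_i/2\rfloor\}$, $$\sum_{i=1}^{s}\kappa_i(\mu_i-\kappa_i)\;\le\; C_{\mathrm{MMC}}\;\le\;\sum_{i=1}^{s}\kappa_i(\mu_i-\kappa_i)+\log_q\left(4^s\binom{n+s}{s}\right).$$ **Asymptotic capacity.** Fix $R$, a real $\bar n>0$ and $\bar\mu=(\bar\mu_1,\dots,\bar\mu_s)$, and put $|\bar\mu|=\sum_i\bar\mu_i$. Let $n$, $N\ge n$ and $\mu$ vary along any sequence for which $n/m=\bar n$ and $\mu/m=\bar\mu$ are fixed and $m=\mu_s\to\infty$. Then $\kappa_i/m\to\bar\kappa_i:=\min\{\bar n,\bar\mu_i/2\}$ for every $i$, and $$\bar C_{\mathrm{MMC}}=\lim_{m\to\infty}\frac{C_{\mathrm{MMC}}}{n|\mu|}=\frac{\sum_{i=1}^{s}\bar\kappa_i(\bar\mu_i-\bar\kappa_i)}{\bar n\,|\bar\mu|}.$$ -/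

import Mathlib

open Filter Topology

namespace MatrixChannel

/-- `R` is a finite `(q, s)` chain ring with maximal ideal `⟨π⟩`: it is finite, its ideals form a
chain, its residue field `R / ⟨π⟩` has `q` elements, and `s` is the smallest positive integer with
`π ^ s = 0`. -/
structure IsFiniteChainRing (R : Type*) [CommRing R] (π : R) (q s : ℕ) : Prop where
  finite : Finite R
  chain : ∀ I J : Ideal R, I ≤ J ∨ J ≤ I
  maximal : (Ideal.span {π}).IsMaximal
  residue_card : Nat.card (R ⧸ Ideal.span {π}) = q
  chain_length : IsLeast {k : ℕ | 0 < k ∧ π ^ k = 0} s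

/-- An `s`-shape: a nondecreasing sequence of `s` natural numbers `μ₁ ≤ ⋯ ≤ μ_s`
(the part `μ_{i+1}` is `μ i` with `i : Fin s`). -/
abbrev Shape (s : ℕ) := Fin s →o ℕ

/-- The packet length `m = μ_s`, the largest part of the shape. -/
def packetLength {s : ℕ} (μ : Shape s) : ℕ := Finset.univ.sup μ

/-- The sum of the parts `|μ| = μ₁ + ⋯ + μ_s`. -/
def Shape.size {s : ℕ} (μ : Shape s) : ℕ := ∑ i, μ i

/-- The module `R^μ`: the product, inside `R ^ (μ_s)`, of `μ₁` copies of `⟨1⟩`, then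
`μ₂ - μ₁` copies of `⟨π⟩`, ..., then `μ_s - μ_{s-1}` copies of `⟨π ^ (s-1)⟩`. The coordinate with
(zero-based) index `j` ranges over `⟨π ^ e⟩`, where `e` is the number of parts of `μ` that are
at most `j`. -/
def shapeModule {R : Type*} [CommRing R] (π : R) {s : ℕ} (μ : Shape s) :
    Submodule R (Fin (packetLength μ) → R) :=
  Submodule.pi Set.univ
    (fun j => Ideal.span {π ^ (Finset.univ.filter (fun i : Fin s => μ i ≤ (j : ℕ))).card})

/-- The module `M` has shape `μ`, that is, `M ≅ R^μ`. -/
def HasShape {R : Type*} [CommRing R] (π : R) {s : ℕ} (M : Type*) [AddCommGroup M] [Module R M]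
    (μ : Shape s) : Prop :=
  Nonempty (M ≃ₗ[R] shapeModule π μ)

/-- The row span of a matrix. -/
def rowSpan {R : Type*} [CommRing R] {k l : ℕ} (A : Matrix (Fin k) (Fin l) R) :
    Submodule R (Fin l → R) :=
  Submodule.span R (Set.range fun i => A i)

/-- A `k × l` matrix has full row rank if its shape, which is the shape of its row span,
is `(k, …, k)`. -/
def IsFullRowRank {R : Type*} [CommRing R] (π : R) (s : ℕ) {k l : ℕ}
    (A : Matrix (Fin k) (Fin l) R) : Prop :=
  HasShape π (rowSpan A) (OrderHom.const (Fin s) k)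

/-- A matrix has full column rank if its transpose has full row rank. -/
def IsFullColumnRank {R : Type*} [CommRing R] (π : R) (s : ℕ) {k l : ℕ}
    (A : Matrix (Fin k) (Fin l) R) : Prop :=
  IsFullRowRank π s A.transpose

/-- `R^{n × μ}`: the matrices with `n` rows, each of which belongs to `R^μ`. -/
def RowMatrix {R : Type*} [CommRing R] (π : R) {s : ℕ} (n : ℕ) (μ : Shape s) : Type _ :=
  {X : Matrix (Fin n) (Fin (packetLength μ)) R // ∀ i, X i ∈ shapeModule π μ}

instance {R : Type*} [CommRing R] [Finite R] (π : R) {s : ℕ} (n : ℕ) (μ : Shape s) :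
    Finite (RowMatrix π n μ) :=
  inferInstanceAs
    (Finite {X : Matrix (Fin n) (Fin (packetLength μ)) R // ∀ i, X i ∈ shapeModule π μ})

noncomputable instance {R : Type*} [CommRing R] [Finite R] (π : R) {s : ℕ} (n : ℕ) (μ : Shape s) :
    Fintype (RowMatrix π n μ) :=
  Fintype.ofFinite _

/-- The mutual information `I(X; Y)`, in base-`b` units, of a pair of finite-valued random
variables with joint probability mass function `P` (terms with `P x y = 0` vanish). -/
noncomputable def mutualInfo {α β : Type*} [Fintype α] [Fintype β] (b : ℝ) (P : α → β → ℝ) : ℝ :=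
  ∑ x, ∑ y, P x y * Real.logb b (P x y / ((∑ y', P x y') * (∑ x', P x' y)))

/-- The values of `I(X; Y)`, in base-`b` units, over all input distributions `p` of the discrete
memoryless channel with transition probabilities `W x y = p_{Y|X}(y | x)`. -/
def channelInfos {α β : Type*} [Fintype α] [Fintype β] (b : ℝ) (W : α → β → ℝ) : Set ℝ :=
  {I | ∃ p ∈ stdSimplex ℝ α, I = mutualInfo b (fun x y => p x * W x y)}

/-- The transition probability `p_{Y|X}(Y | X)` of the multiplicative matrix channel `Y = A X`,
where `A` is uniform over the full-column-rank matrices in `R^{N × n}`, independently of `X`: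
the proportion of those matrices `A` for which `A X = Y`. -/
noncomputable def mmcTransition {R : Type*} [CommRing R] (π : R) {s : ℕ} {n N : ℕ} {μ : Shape s}
    (X : RowMatrix π n μ) (Y : RowMatrix π N μ) : ℝ :=
  (Nat.card {A : Matrix (Fin N) (Fin n) R // IsFullColumnRank π s A ∧ A * X.1 = Y.1} : ℝ) /
    (Nat.card {A : Matrix (Fin N) (Fin n) R // IsFullColumnRank π s A} : ℝ)

/-- The values of `I(X; Y)`, in `q`-ary units, over all distributions of the input
`X ∈ R^{n × μ}` of the multiplicative matrix channel with output `Y ∈ R^{N × μ}`. -/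
noncomputable def mmcInfos {R : Type*} [CommRing R] [Finite R] (π : R) (q : ℕ) {s : ℕ} (n N : ℕ)
    (μ : Shape s) : Set ℝ :=
  channelInfos (q : ℝ)
    (fun (X : RowMatrix π n μ) (Y : RowMatrix π N μ) => mmcTransition π X Y)

/-- The capacity of the multiplicative matrix channel, in `q`-ary units per channel use. -/
noncomputable def mmcCapacity {R : Type*} [CommRing R] [Finite R] (π : R) (q : ℕ) {s : ℕ}
    (n N : ℕ) (μ : Shape s) : ℝ :=
  sSup (mmcInfos π q n N μ)

/-- `κ_i = min {n, ⌊μ_i / 2⌋}`. -/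
def kappa {s : ℕ} (n : ℕ) (μ : Shape s) (i : Fin s) : ℕ := min n (μ i / 2)

end MatrixChannel

open MatrixChannel

/-! A full-column-rank `A` has a left inverse, so `Y = A X` has the same row span as `X`.
Conversely, over a local ring two inputs with equal row span differ by an invertible left factor
(`exists_isUnit_mul_eq_of_rowSpan_eq`), and right multiplication by an invertible matrix permutes
the possible `A`. Hence the output reveals the row span of the input and nothing else: `I(X; Y)` is
the entropy of the row span, and the capacity is `log_q L`, where `L` is the number of submodules of
`R^μ` generated by `n` elements (`isGreatest_mmcInfos`). It remains to count: with `E = ∑ κ_i (μ_i -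
κ_i)`, `q ^ E ≤ L ≤ 4 ^ s * (n + s choose s) * q ^ E`.

Upper bound. Let `T` be the `π`-torsion. For `U` generated by `n` elements, the dimensions `l_i` of
`π^i U ∩ T` over the residue field decrease weakly and are at most `n`, which leaves `(n + s choose
s)` sequences. For a fixed `πU` and a fixed `l = dim (U ∩ T)`, there are at most `4 q^(l(a - l))`
submodules `U` of `M`, where `a` bounds `dim (M ∩ T)` (`ncard_submodule_fiber_mul_le`). Among `l ≤
n` the exponent is at most its value at `min n (a / 2)`. Passing from `M` to `πM` removes one layer,
and the `s` layers of `R^μ` have dimensions `μ_s, …, μ_1` (`ncard_submodule_le`).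

Lower bound. Reduced echelon matrices with pivots on the diagonal have `κ_t (μ_t - κ_t)` free digits
at the power `π ^ t`, each with `q` choices, and different digits give different row spans
(`rowSpan_echelonMatrix_injective`).

The limit follows because `E` grows like `m²` and the logarithmic error is `O(m)`. -/

/-! ### Channels that reveal exactly a class of the input -/

/-- For a channel whose output reveals exactly the class `r x` of the input, the mutual information
is the entropy of that class. -/
theorem mutualInfo_eq_class_entropy {α β γ : Type*} [Fintype α] [Fintype β] [DecidableEq γ]
    (b : ℝ) (W : α → β → ℝ) (r : α → γ) (r' : β → γ)
    (hzero : ∀ x y, r x ≠ r' y → W x y = 0)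
    (hcongr : ∀ x x' y, r x = r x' → W x y = W x' y)
    (hsum : ∀ x, ∑ y, W x y = 1) (p : α → ℝ) (hp : ∀ x, 0 ≤ p x) :
    mutualInfo b (fun x y => p x * W x y) =
      ∑ x, p x * Real.logb b (1 / ∑ x' with r x' = r x, p x') := by
  unfold mutualInfo
  refine Finset.sum_congr rfl fun x _ => ?_
  -- When `W x y` and `p x` are nonzero, only inputs in the class of `x` can produce `y`, all with
  -- probability `W x y`; this factor cancels and leaves the class probability.
  have hmain : ∀ y, p x * W x y * Real.logb b (p x * W x y /
      ((∑ y', p x * W x y') * (∑ x', p x' * W x' y))) =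
      W x y * (p x * Real.logb b (1 / ∑ x' with r x' = r x, p x')) := by
    intro y
    by_cases hW : W x y = 0
    · simp [hW]
    by_cases hpx : p x = 0
    · simp [hpx]
    have hr : r x = r' y := by
      by_contra h
      exact hW (hzero x y h)
    have h1 : ∑ y', p x * W x y' = p x := by
      rw [← Finset.mul_sum, hsum, mul_one]
    have h2 : ∑ x', p x' * W x' y = (∑ x' with r x' = r x, p x') * W x y := by
      rw [Finset.sum_filter, Finset.sum_mul]
      refine Finset.sum_congr rfl fun x' _ => ?_
      split_ifs with h
      · rw [hcongr x' x y h]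
      · rw [hzero x' y (by rwa [← hr])]
        simp
    have hQ : (∑ x' with r x' = r x, p x') ≠ 0 := by
      have : p x ≤ ∑ x' with r x' = r x, p x' :=
        Finset.single_le_sum (f := p) (fun i _ => hp i) (by simp)
      have := lt_of_le_of_ne (hp x) (Ne.symm hpx)
      linarith
    rw [h1, h2]
    have : p x * W x y / (p x * ((∑ x' with r x' = r x, p x') * W x y)) =
        1 / ∑ x' with r x' = r x, p x' := by
      field_simp
    rw [this]
    ring
  rw [Finset.sum_congr rfl fun y _ => hmain y, ← Finset.sum_mul, hsum, one_mul]

/-- The entropy of the class of a random variable is at most the logarithm of the number of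
classes. -/
theorem class_entropy_le {α γ : Type*} [Fintype α] [DecidableEq γ] {b : ℝ} (hb : 1 < b)
    (r : α → γ) (p : α → ℝ) (hp : p ∈ stdSimplex ℝ α) :
    ∑ x, p x * Real.logb b (1 / ∑ x' with r x' = r x, p x') ≤
      Real.logb b ((Finset.univ.image r).card : ℝ) := by
  obtain ⟨hp0, hp1⟩ := hp
  set Q : γ → ℝ := fun u => ∑ x' with r x' = u, p x' with hQ
  have hne : (Finset.univ : Finset α).Nonempty := by
    rw [Finset.nonempty_iff_ne_empty]
    intro h
    rw [h] at hp1
    simp at hp1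
  have hL : (0 : ℝ) < ((Finset.univ.image r).card : ℝ) := by
    exact_mod_cast (hne.image r).card_pos
  set L : ℝ := ((Finset.univ.image r).card : ℝ) with hLdef
  have hlogb : 0 < Real.log b := Real.log_pos hb
  have hQ0 : ∀ u, 0 ≤ Q u := fun u => Finset.sum_nonneg fun i _ => hp0 i
  have hfib : ∀ g : γ → ℝ, ∑ x, p x * g (r x) = ∑ u ∈ Finset.univ.image r, Q u * g u := by
    intro g
    rw [← Finset.sum_fiberwise_of_maps_to (s := Finset.univ) (t := Finset.univ.image r) (g := r)
      (fun x _ => Finset.mem_image_of_mem r (Finset.mem_univ x))]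
    refine Finset.sum_congr rfl fun u _ => ?_
    rw [hQ, Finset.sum_mul]
    refine Finset.sum_congr rfl fun x hx => ?_
    rw [(Finset.mem_filter.1 hx).2]
  have hQsum : ∑ u ∈ Finset.univ.image r, Q u = 1 := by
    have := hfib fun _ => 1
    simpa [hp1] using this.symm
  -- Gibbs' inequality, from `log t ≤ t - 1` at `t = 1 / (L * Q u)`; a class of probability zero is
  -- treated apart.
  have hterm : ∀ u, Q u * (Real.logb b (1 / Q u) - Real.logb b L) ≤
      (1 / L - Q u) / Real.log b := by
    intro u
    rcases (hQ0 u).eq_or_lt with h | h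
    · rw [← h]
      simp only [zero_mul, sub_zero]
      positivity
    · have h3 : Real.logb b (1 / Q u) - Real.logb b L = Real.log (1 / (L * Q u)) / Real.log b := by
        rw [← Real.logb_div (by positivity) (by positivity), Real.logb]
        congr 2
        field_simp
      have h4 := Real.log_le_sub_one_of_pos (x := 1 / (L * Q u)) (by positivity)
      rw [h3, ← mul_div_assoc]
      gcongr
      calc Q u * Real.log (1 / (L * Q u)) ≤ Q u * (1 / (L * Q u) - 1) := by gcongr
        _ = 1 / L - Q u := by field_simp
  have htotal : ∑ u ∈ Finset.univ.image r, Q u * (Real.logb b (1 / Q u) - Real.logb b L) ≤ 0 := by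
    refine (Finset.sum_le_sum fun u _ => hterm u).trans ?_
    rw [← Finset.sum_div, Finset.sum_sub_distrib, hQsum, Finset.sum_const, nsmul_eq_mul]
    rw [← hLdef, mul_one_div_cancel hL.ne']
    simp
  have := hfib fun u => Real.logb b (1 / Q u)
  rw [this]
  simp only [mul_sub, Finset.sum_sub_distrib, ← Finset.sum_mul, hQsum, one_mul] at htotal
  linarith

/-- The uniform distribution on a set of representatives of the classes has class entropy equal to
the logarithm of the number of classes. -/
theorem exists_class_entropy_eq {α γ : Type*} [Fintype α] [Nonempty α] [DecidableEq γ] (b : ℝ)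
    (r : α → γ) :
    ∃ p ∈ stdSimplex ℝ α, ∑ x, p x * Real.logb b (1 / ∑ x' with r x' = r x, p x') =
      Real.logb b ((Finset.univ.image r).card : ℝ) := by
  classical
  have hL : (0 : ℝ) < ((Finset.univ.image r).card : ℝ) := by
    exact_mod_cast (Finset.univ_nonempty.image r).card_pos
  set L : ℝ := ((Finset.univ.image r).card : ℝ) with hLdef
  let σ : α → α := fun x => Function.invFun r (r x)
  have hσ : ∀ x, r (σ x) = r x := fun x => Function.invFun_eq ⟨x, rfl⟩
  let p : α → ℝ := fun x => if x = σ x then 1 / L else 0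
  have hQ : ∀ x, ∑ x' with r x' = r x, p x' = 1 / L := by
    intro x
    have h1 : ∀ x' ∈ Finset.univ.filter (fun x' => r x' = r x),
        p x' = if x' = σ x then 1 / L else 0 := by
      intro x' hx'
      have : σ x' = σ x := by simp [σ, (Finset.mem_filter.1 hx').2]
      simp only [p, this]
    rw [Finset.sum_congr rfl h1, Finset.sum_ite_eq', if_pos (by simp [hσ])]
  have hsum : ∑ x, p x = 1 := by
    rw [← Finset.sum_fiberwise_of_maps_to (s := Finset.univ) (t := Finset.univ.image r) (g := r)
      (fun x _ => Finset.mem_image_of_mem r (Finset.mem_univ x))]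
    have : ∀ u ∈ Finset.univ.image r, ∑ x' with r x' = u, p x' = 1 / L := by
      intro u hu
      obtain ⟨x, -, rfl⟩ := Finset.mem_image.1 hu
      exact hQ x
    rw [Finset.sum_congr rfl this, Finset.sum_const, nsmul_eq_mul, ← hLdef,
      mul_one_div_cancel hL.ne']
  refine ⟨p, ⟨fun x => ?_, hsum⟩, ?_⟩
  · simp only [p]
    split_ifs <;> positivity
  · simp only [hQ, one_div_one_div, ← Finset.sum_mul, hsum, one_mul]

/-- The greatest mutual information over a channel whose output reveals exactly the class `r x` of
the input is the logarithm of the number of classes. -/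
theorem isGreatest_channelInfos {α β γ : Type*} [Fintype α] [Nonempty α] [Fintype β]
    {b : ℝ} (hb : 1 < b) (W : α → β → ℝ) (r : α → γ) (r' : β → γ)
    (hzero : ∀ x y, r x ≠ r' y → W x y = 0)
    (hcongr : ∀ x x' y, r x = r x' → W x y = W x' y)
    (hsum : ∀ x, ∑ y, W x y = 1) :
    IsGreatest (channelInfos b W) (Real.logb b ((Set.range r).ncard : ℝ)) := by
  classical
  have hcard : (Set.range r).ncard = (Finset.univ.image r).card := by
    rw [← Set.ncard_coe_finset]
    simp
  rw [hcard]
  constructor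
  · obtain ⟨p, hp, h⟩ := exists_class_entropy_eq b r
    exact ⟨p, hp, by rw [mutualInfo_eq_class_entropy b W r r' hzero hcongr hsum p hp.1, h]⟩
  · rintro I ⟨p, hp, rfl⟩
    rw [mutualInfo_eq_class_entropy b W r r' hzero hcongr hsum p hp.1]
    exact class_entropy_le hb r p hp

/-! ### Finite chain rings -/

namespace MatrixChannel.IsFiniteChainRing

variable {R : Type*} [CommRing R] {π : R} {q s : ℕ}

theorem isLocalRing (h : IsFiniteChainRing R π q s) : IsLocalRing R := by
  refine IsLocalRing.of_unique_max_ideal ⟨_, h.maximal, fun J hJ => ?_⟩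
  rcases h.chain J (Ideal.span {π}) with h1 | h1
  · exact hJ.eq_of_le h.maximal.ne_top h1
  · exact (h.maximal.eq_of_le hJ.ne_top h1).symm

theorem isUnit_or_dvd (h : IsFiniteChainRing R π q s) (x : R) : IsUnit x ∨ π ∣ x := by
  have := h.isLocalRing
  by_cases hx : IsUnit x
  · exact Or.inl hx
  · have h1 : x ∈ IsLocalRing.maximalIdeal R := hx
    rw [← IsLocalRing.eq_maximalIdeal h.maximal] at h1
    exact Or.inr (Ideal.mem_span_singleton.1 h1)

theorem one_lt_residue_card (h : IsFiniteChainRing R π q s) : 1 < q := by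
  have := h.finite
  have : Finite (R ⧸ Ideal.span {π}) :=
    Finite.of_surjective _ (Ideal.Quotient.mk_surjective (I := Ideal.span {π}))
  have : Nontrivial (R ⧸ Ideal.span {π}) := Ideal.Quotient.nontrivial_iff.2 h.maximal.ne_top
  rw [← h.residue_card]
  exact Finite.one_lt_card

theorem length_pos (h : IsFiniteChainRing R π q s) : 0 < s := h.chain_length.1.1

theorem pow_length (h : IsFiniteChainRing R π q s) : π ^ s = 0 := h.chain_length.1.2

theorem pow_ne_zero (h : IsFiniteChainRing R π q s) {k : ℕ} (hk : k < s) : π ^ k ≠ 0 := by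
  intro h0
  have := h.isLocalRing
  rcases Nat.eq_zero_or_pos k with rfl | hk0
  · simp at h0
  · exact absurd (h.chain_length.2 ⟨hk0, h0⟩) (by omega)

/-- A non-multiple of `π` is a unit, and `π ^ k` is nonzero below the chain length. -/
theorem dvd_of_pow_mul_eq_zero (h : IsFiniteChainRing R π q s) {k : ℕ} (hk : k < s) {x : R}
    (hx : π ^ k * x = 0) : π ∣ x := by
  rcases h.isUnit_or_dvd x with hu | hd
  · exact absurd (hu.mul_left_eq_zero.1 hx) (h.pow_ne_zero hk)
  · exact hd

end MatrixChannel.IsFiniteChainRing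

/-! ### Row spans and left multiplication -/

/-- If two endomorphisms of a finite-dimensional space have no common kernel, then a multiple of
the second can be added to the first to make it injective. -/
theorem LinearMap.exists_ker_add_comp_eq_bot {K V : Type*} [Field K] [AddCommGroup V] [Module K V]
    [FiniteDimensional K V] (f e : V →ₗ[K] V) (hfe : LinearMap.ker f ⊓ LinearMap.ker e = ⊥) :
    ∃ d : V →ₗ[K] V, LinearMap.ker (f + d ∘ₗ e) = ⊥ := by
  obtain ⟨W, hW⟩ := (LinearMap.range f).exists_isCompl
  have hinj : Function.Injective (e.domRestrict (LinearMap.ker f)) := by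
    rw [← LinearMap.ker_eq_bot, LinearMap.ker_eq_bot']
    rintro ⟨x, hx⟩ hex
    have : x ∈ LinearMap.ker f ⊓ LinearMap.ker e := ⟨hx, hex⟩
    rw [hfe] at this
    simpa using this
  let P := LinearMap.range (e.domRestrict (LinearMap.ker f))
  -- `e` is injective on `ker f`, so `P = e (ker f)` has the dimension of `ker f`, which is the
  -- codimension of `range f`. Thus `d` can send `P` isomorphically onto a complement `W`, and `f v
  -- + d (e v) = 0` forces both terms to vanish.
  have hrank : Module.finrank K P = Module.finrank K W := by
    have h1 := LinearMap.finrank_range_of_inj hinj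
    have h2 := f.finrank_range_add_finrank_ker
    have h3 := Submodule.finrank_add_eq_of_isCompl hW
    change Module.finrank K (LinearMap.range (e.domRestrict (LinearMap.ker f))) = _
    omega
  let φ : P ≃ₗ[K] W := LinearEquiv.ofFinrankEq _ _ hrank
  obtain ⟨d, hd⟩ := LinearMap.exists_extend φ.toLinearMap
  refine ⟨W.subtype ∘ₗ d, LinearMap.ker_eq_bot'.2 fun v hv => ?_⟩
  have hd0 : ((d (e v) : W) : V) = 0 := by
    have h1 : f v = -(d (e v) : V) := eq_neg_of_add_eq_zero_left hv
    have h2 : (d (e v) : V) ∈ LinearMap.range f ⊓ W :=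
      ⟨⟨-v, by rw [map_neg, h1, neg_neg]⟩, (d (e v)).2⟩
    rw [hW.inf_eq_bot] at h2
    simpa using h2
  have hfv : f v = 0 := by
    have : f v + (d (e v) : V) = 0 := hv
    rwa [hd0, add_zero] at this
  let y : P := ⟨e v, ⟨⟨v, hfv⟩, rfl⟩⟩
  have hy : φ y = 0 := by
    have h1 : d (e v) = φ y := LinearMap.congr_fun hd y
    rw [← h1]
    exact Subtype.ext hd0
  have hev : e v = 0 := congrArg Subtype.val ((LinearEquiv.map_eq_zero_iff φ).1 hy)
  have : v ∈ LinearMap.ker f ⊓ LinearMap.ker e := ⟨hfv, hev⟩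
  rw [hfe] at this
  simpa using this

/-- Matrices over a local ring have stable range one. -/
theorem Matrix.exists_isUnit_add_mul {R : Type*} [CommRing R] [IsLocalRing R] {n : ℕ}
    (B C : Matrix (Fin n) (Fin n) R) :
    ∃ D : Matrix (Fin n) (Fin n) R, IsUnit (B + D * (1 - C * B)) := by
  let φ := IsLocalRing.residue R
  let B' := φ.mapMatrix B
  let E' := φ.mapMatrix (1 - C * B)
  have hCB : φ.mapMatrix C * B' + E' = 1 := by
    simp only [B', E', ← map_mul, ← map_add, add_sub_cancel, map_one]
  obtain ⟨d, hd⟩ := LinearMap.exists_ker_add_comp_eq_bot (Matrix.toLin' B') (Matrix.toLin' E') (by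
    rw [eq_bot_iff]
    rintro v ⟨h1, h2⟩
    have h1' : B'.mulVec v = 0 := h1
    have h2' : E'.mulVec v = 0 := h2
    have h3 : (φ.mapMatrix C * B' + E').mulVec v = v := by rw [hCB, Matrix.one_mulVec]
    rw [Matrix.add_mulVec, ← Matrix.mulVec_mulVec, h1', h2', Matrix.mulVec_zero, add_zero] at h3
    exact h3.symm)
  let D' := LinearMap.toMatrix' d
  -- A square matrix over a local ring is invertible as soon as its reduction is, so any entrywise
  -- lift of the solution over the residue field works.
  choose g hg using IsLocalRing.residue_surjective (R := R)
  refine ⟨D'.map g, ?_⟩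
  rw [Matrix.isUnit_iff_isUnit_det, ← isUnit_map_iff φ, RingHom.map_det,
    ← Matrix.isUnit_iff_isUnit_det]
  have hD : φ.mapMatrix (D'.map g) = D' := by
    ext i j
    simp [φ, hg]
  have hmat : φ.mapMatrix (B + D'.map g * (1 - C * B)) = B' + D' * E' := by
    rw [map_add, map_mul, hD]
  rw [hmat, ← Matrix.mulVec_injective_iff_isUnit]
  have : Matrix.toLin' (B' + D' * E') = Matrix.toLin' B' + d ∘ₗ Matrix.toLin' E' := by
    rw [map_add, Matrix.toLin'_mul, Matrix.toLin'_toMatrix']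
  rw [← this, LinearMap.ker_eq_bot] at hd
  exact hd

section RowSpan

variable {R : Type*} [CommRing R]

theorem mem_rowSpan_iff {k l : ℕ} {A : Matrix (Fin k) (Fin l) R} {x : Fin l → R} :
    x ∈ rowSpan A ↔ ∃ c : Fin k → R, Matrix.vecMul c A = x := by
  have : rowSpan A = LinearMap.range A.vecMulLinear := by
    rw [range_vecMulLinear]
    rfl
  rw [this]
  rfl

theorem rowSpan_le_iff {k k' l : ℕ} {A : Matrix (Fin k) (Fin l) R} {B : Matrix (Fin k') (Fin l) R} :
    rowSpan B ≤ rowSpan A ↔ ∃ C : Matrix (Fin k') (Fin k) R, C * A = B := by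
  constructor
  · intro h
    have h1 : ∀ i, ∃ c : Fin k → R, Matrix.vecMul c A = B i := fun i =>
      mem_rowSpan_iff.1 (h (Submodule.subset_span ⟨i, rfl⟩))
    choose c hc using h1
    exact ⟨Matrix.of c, by ext i j; exact congrFun (hc i) j⟩
  · rintro ⟨C, rfl⟩
    refine Submodule.span_le.2 ?_
    rintro _ ⟨i, rfl⟩
    exact mem_rowSpan_iff.2 ⟨C i, rfl⟩

theorem rowSpan_mul_eq {k k' l : ℕ} {A : Matrix (Fin k) (Fin k') R} {B : Matrix (Fin k') (Fin k) R}
    (h : B * A = 1) (X : Matrix (Fin k') (Fin l) R) : rowSpan (A * X) = rowSpan X :=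
  le_antisymm (rowSpan_le_iff.2 ⟨A, rfl⟩)
    (rowSpan_le_iff.2 ⟨B, by rw [← Matrix.mul_assoc, h, Matrix.one_mul]⟩)

/-- Over a local ring, matrices of the same size with the same row span differ by an invertible
left factor. -/
theorem exists_isUnit_mul_eq_of_rowSpan_eq [IsLocalRing R] {n l : ℕ}
    {X X' : Matrix (Fin n) (Fin l) R} (h : rowSpan X = rowSpan X') :
    ∃ G : Matrix (Fin n) (Fin n) R, IsUnit G ∧ G * X = X' := by
  obtain ⟨B, hB⟩ := rowSpan_le_iff.1 h.ge
  obtain ⟨C, hC⟩ := rowSpan_le_iff.1 h.le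
  -- Since `C * B` fixes `X`, the factor `1 - C * B` kills it: every choice of `D` still sends `X`
  -- to `X'`.
  obtain ⟨D, hD⟩ := Matrix.exists_isUnit_add_mul B C
  refine ⟨_, hD, ?_⟩
  rw [Matrix.add_mul, Matrix.mul_assoc, Matrix.sub_mul, Matrix.mul_assoc, hB, hC, Matrix.one_mul,
    sub_self, Matrix.mul_zero, add_zero]

theorem mul_mem_shapeModule {π : R} {s : ℕ} {μ : Shape s} {n N : ℕ}
    (A : Matrix (Fin N) (Fin n) R) {X : Matrix (Fin n) (Fin (packetLength μ)) R}
    (hX : ∀ i, X i ∈ shapeModule π μ) (i : Fin N) : (A * X) i ∈ shapeModule π μ := by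
  have h1 : rowSpan X ≤ shapeModule π μ := Submodule.span_le.2 (by rintro _ ⟨i, rfl⟩; exact hX i)
  exact h1 (mem_rowSpan_iff.2 ⟨A i, rfl⟩)

theorem shapeModule_const {π : R} {s : ℕ} (n : ℕ) :
    shapeModule π (OrderHom.const (Fin s) n) = ⊤ := by
  refine eq_top_iff.2 fun x _ => Submodule.mem_pi.2 fun j _ => ?_
  have hj : (j : ℕ) < n := j.2.trans_le (Finset.sup_le fun i _ => le_rfl)
  have : (Finset.univ.filter fun i : Fin s => (OrderHom.const (Fin s) n) i ≤ (j : ℕ)).card = 0 := by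
    rw [Finset.card_eq_zero, Finset.filter_eq_empty_iff]
    intro i _
    simpa using hj
  rw [this, pow_zero, Ideal.span_singleton_one]
  trivial

/-- For `s = 0` the supremum would be empty and equal to `0`, whatever `n` is. -/
theorem packetLength_const {s : ℕ} (hs : 0 < s) (n : ℕ) :
    packetLength (OrderHom.const (Fin s) n) = n := by
  have : Nonempty (Fin s) := ⟨⟨0, hs⟩⟩
  exact Finset.sup_const Finset.univ_nonempty n

/-- A full-column-rank matrix over a finite ring is one whose columns are linearly independent. -/
theorem isFullColumnRank_iff_injective [Finite R] {π : R} {s : ℕ} (hs : 0 < s) {N n : ℕ}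
    (A : Matrix (Fin N) (Fin n) R) :
    IsFullColumnRank π s A ↔ Function.Injective A.mulVec := by
  have hrange : LinearMap.range A.mulVecLin = rowSpan A.transpose := A.range_mulVecLin
  have e : shapeModule π (OrderHom.const (Fin s) n) ≃ₗ[R] (Fin n → R) :=
    (LinearEquiv.ofEq _ _ (shapeModule_const n)).trans
      (Submodule.topEquiv.trans (LinearEquiv.funCongrLeft R R
        (finCongr (packetLength_const hs n)).symm))
  constructor
  · rintro ⟨φ⟩
    have hcard : Nat.card (LinearMap.range A.mulVecLin) = Nat.card (Fin n → R) := by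
      rw [hrange]
      exact Nat.card_congr (φ.trans e).toEquiv
    have hbij := (Nat.bijective_iff_surjective_and_card A.mulVecLin.rangeRestrict).2
      ⟨A.mulVecLin.surjective_rangeRestrict, hcard.symm⟩
    intro x y hxy
    exact hbij.1 (Subtype.ext hxy)
  · intro h
    exact ⟨(LinearEquiv.ofEq _ _ hrange.symm).trans
      ((LinearEquiv.ofInjective A.mulVecLin h).symm.trans e.symm)⟩

/-- Over a finite chain ring, a matrix with linearly independent columns has a left inverse. -/
theorem MatrixChannel.IsFiniteChainRing.exists_left_inverse {π : R} {q s : ℕ}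
    (hR : IsFiniteChainRing R π q s) {N n : ℕ} {A : Matrix (Fin N) (Fin n) R}
    (hA : Function.Injective A.mulVec) : ∃ B : Matrix (Fin n) (Fin N) R, B * A = 1 := by
  have := hR.isLocalRing
  have hs := hR.length_pos
  let φ := IsLocalRing.residue R
  have hφ : ∀ x : R, φ x = 0 ↔ π ∣ x := by
    intro x
    rw [IsLocalRing.residue_eq_zero_iff, ← IsLocalRing.eq_maximalIdeal hR.maximal,
      Ideal.mem_span_singleton]
  choose g hg using IsLocalRing.residue_surjective (R := R)
  -- The columns stay independent in the residue field: if `w` lifts a kernel vector `v`, then `π`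
  -- divides `A w`, so `A` kills `π ^ (s - 1) • w`. Hence that vector is zero, `π` divides `w`, and
  -- `v = 0`.
  have hker : LinearMap.ker (Matrix.toLin' (A.map φ)) = ⊥ := by
    refine LinearMap.ker_eq_bot'.2 fun v hv => ?_
    have hv' : (A.map φ).mulVec v = 0 := hv
    let w : Fin n → R := fun i => g (v i)
    have hw : φ ∘ w = v := funext fun i => hg (v i)
    have h1 : ∀ i, π ∣ A.mulVec w i := by
      intro i
      rw [← hφ, RingHom.map_mulVec, hw, hv']
      rfl
    have h2 : A.mulVec (π ^ (s - 1) • w) = A.mulVec 0 := by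
      rw [Matrix.mulVec_smul, Matrix.mulVec_zero]
      ext i
      obtain ⟨c, hc⟩ := h1 i
      rw [Pi.smul_apply, hc, smul_eq_mul, ← mul_assoc, ← pow_succ, Nat.sub_add_cancel hs,
        hR.pow_length, zero_mul]
      rfl
    have h3 := hA h2
    ext i
    have h4 : π ^ (s - 1) * w i = 0 := congrFun h3 i
    rw [← hw]
    exact (hφ _).2 (hR.dvd_of_pow_mul_eq_zero (by omega) h4)
  obtain ⟨b, hb⟩ := LinearMap.exists_leftInverse_of_injective _ hker
  let B := (LinearMap.toMatrix' b).map g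
  have hBφ : B.map φ = LinearMap.toMatrix' b := by
    ext i j
    simp [B, φ, hg]
  have hBA : IsUnit (B * A) := by
    rw [Matrix.isUnit_iff_isUnit_det, ← isUnit_map_iff φ, RingHom.map_det]
    have : φ.mapMatrix (B * A) = 1 := by
      rw [RingHom.mapMatrix_apply, Matrix.map_mul, hBφ]
      apply Matrix.toLin'.injective
      rw [Matrix.toLin'_mul, Matrix.toLin'_toMatrix', hb, Matrix.toLin'_one]
    rw [this, Matrix.det_one]
    exact isUnit_one
  obtain ⟨u, hu⟩ := hBA
  exact ⟨(↑u⁻¹ : Matrix (Fin n) (Fin n) R) * B, by rw [Matrix.mul_assoc, ← hu, Units.inv_mul]⟩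

end RowSpan

/-! ### The capacity counts row spans -/

section Capacity

variable {R : Type*} [CommRing R] [Finite R] {π : R} {q s : ℕ}

theorem rowSpan_eq_of_isFullColumnRank (hR : IsFiniteChainRing R π q s) {N n l : ℕ}
    {A : Matrix (Fin N) (Fin n) R} (hA : IsFullColumnRank π s A) (X : Matrix (Fin n) (Fin l) R) :
    rowSpan (A * X) = rowSpan X := by
  obtain ⟨B, hB⟩ := hR.exists_left_inverse ((isFullColumnRank_iff_injective hR.length_pos A).1 hA)
  exact rowSpan_mul_eq hB X

theorem card_isFullColumnRank_pos (hR : IsFiniteChainRing R π q s) {n N : ℕ} (hn : n ≤ N) :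
    0 < Nat.card {A : Matrix (Fin N) (Fin n) R // IsFullColumnRank π s A} := by
  have : Nonempty {A : Matrix (Fin N) (Fin n) R // IsFullColumnRank π s A} := by
    refine ⟨⟨Matrix.of fun i j => if i = Fin.castLE hn j then 1 else 0, ?_⟩⟩
    rw [isFullColumnRank_iff_injective hR.length_pos]
    intro x y hxy
    ext j
    have := congrFun hxy (Fin.castLE hn j)
    simpa [Matrix.mulVec, dotProduct] using this
  exact Nat.card_pos

theorem mmcTransition_eq_zero (hR : IsFiniteChainRing R π q s) {n N : ℕ} {μ : Shape s}
    (X : RowMatrix π n μ) (Y : RowMatrix π N μ) (h : rowSpan X.1 ≠ rowSpan Y.1) :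
    mmcTransition π X Y = 0 := by
  have : IsEmpty {A : Matrix (Fin N) (Fin n) R // IsFullColumnRank π s A ∧ A * X.1 = Y.1} :=
    ⟨fun ⟨A, hA, hAX⟩ => h (by rw [← hAX, rowSpan_eq_of_isFullColumnRank hR hA])⟩
  simp [mmcTransition]

/-- With `u X = X'` and `u` invertible, `A ↦ A u⁻¹` is a bijection from the solutions of `A X = Y`
to those of `A X' = Y`, and it preserves full column rank. -/
theorem mmcTransition_congr (hR : IsFiniteChainRing R π q s) {n N : ℕ} {μ : Shape s}
    (X X' : RowMatrix π n μ) (Y : RowMatrix π N μ) (h : rowSpan X.1 = rowSpan X'.1) :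
    mmcTransition π X Y = mmcTransition π X' Y := by
  have := hR.isLocalRing
  obtain ⟨G, ⟨u, rfl⟩, hGX⟩ := exists_isUnit_mul_eq_of_rowSpan_eq h
  have hfull : ∀ (v : (Matrix (Fin n) (Fin n) R)ˣ) (A : Matrix (Fin N) (Fin n) R),
      IsFullColumnRank π s A → IsFullColumnRank π s (A * (v : Matrix (Fin n) (Fin n) R)) := by
    intro v A
    rw [isFullColumnRank_iff_injective hR.length_pos, isFullColumnRank_iff_injective hR.length_pos]
    intro hA x y hxy
    rw [← Matrix.mulVec_mulVec, ← Matrix.mulVec_mulVec] at hxy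
    exact Matrix.mulVec_injective_of_isUnit v.isUnit (hA hxy)
  have hcard : Nat.card {A : Matrix (Fin N) (Fin n) R // IsFullColumnRank π s A ∧ A * X.1 = Y.1} =
      Nat.card {A : Matrix (Fin N) (Fin n) R // IsFullColumnRank π s A ∧ A * X'.1 = Y.1} := by
    have hX : (↑u⁻¹ : Matrix (Fin n) (Fin n) R) * X'.1 = X.1 := by
      rw [← hGX, ← Matrix.mul_assoc, Units.inv_mul, Matrix.one_mul]
    refine Nat.card_congr
      { toFun := fun A => ⟨A.1 * (↑u⁻¹ : Matrix (Fin n) (Fin n) R), hfull u⁻¹ _ A.2.1, ?_⟩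
        invFun := fun A => ⟨A.1 * (u : Matrix (Fin n) (Fin n) R), hfull u _ A.2.1, ?_⟩
        left_inv := fun A => Subtype.ext ?_
        right_inv := fun A => Subtype.ext ?_ }
    · rw [Matrix.mul_assoc, hX, A.2.2]
    · rw [Matrix.mul_assoc, hGX, A.2.2]
    · simp only [Matrix.mul_assoc, Units.inv_mul, Matrix.mul_one]
    · simp only [Matrix.mul_assoc, Units.mul_inv, Matrix.mul_one]
  unfold mmcTransition
  rw [hcard]

theorem sum_mmcTransition (hR : IsFiniteChainRing R π q s) {n N : ℕ} (hn : n ≤ N) {μ : Shape s}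
    (X : RowMatrix π n μ) : ∑ Y : RowMatrix π N μ, mmcTransition π X Y = 1 := by
  have hpos := card_isFullColumnRank_pos hR hn
  unfold mmcTransition
  rw [← Finset.sum_div, div_eq_one_iff_eq (by exact_mod_cast hpos.ne'), ← Nat.cast_sum,
    ← Nat.card_sigma]
  congr 1
  refine Nat.card_congr
    { toFun := fun p => ⟨p.2.1, p.2.2.1⟩
      invFun := fun A => ⟨⟨A.1 * X.1, mul_mem_shapeModule A.1 X.2⟩, ⟨A.1, A.2, rfl⟩⟩
      left_inv := ?_
      right_inv := fun A => rfl }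
  rintro ⟨⟨Y, hY⟩, ⟨A, hA, hAX⟩⟩
  obtain rfl : A * X.1 = Y := hAX
  rfl

/-- The capacity of the multiplicative matrix channel is attained, and is the logarithm of the
number of row spans of input matrices. -/
theorem isGreatest_mmcInfos (hR : IsFiniteChainRing R π q s) {n N : ℕ} (hn : n ≤ N)
    (μ : Shape s) :
    IsGreatest (mmcInfos π q n N μ)
      (Real.logb q ((Set.range fun X : RowMatrix π n μ => rowSpan X.1).ncard : ℝ)) := by
  have : Nonempty (RowMatrix π n μ) := ⟨⟨0, fun i => (shapeModule π μ).zero_mem⟩⟩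
  exact isGreatest_channelInfos (by exact_mod_cast hR.one_lt_residue_card) _
    (fun X : RowMatrix π n μ => rowSpan X.1) (fun Y : RowMatrix π N μ => rowSpan Y.1)
    (fun X Y => mmcTransition_eq_zero hR X Y) (fun X X' Y => mmcTransition_congr hR X X' Y)
    (sum_mmcTransition hR hn)

theorem mmcCapacity_eq (hR : IsFiniteChainRing R π q s) {n N : ℕ} (hn : n ≤ N) (μ : Shape s) :
    mmcCapacity π q n N μ =
      Real.logb q ((Set.range fun X : RowMatrix π n μ => rowSpan X.1).ncard : ℝ) :=
  (isGreatest_mmcInfos hR hn μ).csSup_eq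

end Capacity

section SubmoduleCounting

open scoped Pointwise

/-! ### Counting submodules from above -/


/-- The product is the order of `GL_d` over the field with `q` elements, that is `q ^ (d * d) * ∏ (1
- q ^ (-j))`. The worst case is `q = 2`, where the product of the factors stays above `1 / 4`. -/
theorem pow_mul_self_le_four_mul_prod {q : ℕ} (hq : 1 < q) (d : ℕ) :
    q ^ (d * d) ≤ 4 * ∏ i : Fin d, (q ^ d - q ^ (i : ℕ)) := by
  have hq0 : (0 : ℝ) < q := by exact_mod_cast (by omega : 0 < q)
  have key : ∀ d : ℕ, (1 / 4 : ℝ) + (1 / 2) ^ (d + 2) ≤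
      ∏ j ∈ Finset.range (d + 1), (1 - (1 / 2 : ℝ) ^ (j + 1)) := by
    intro d
    induction d with
    | zero => norm_num
    | succ d ih =>
      rw [Finset.prod_range_succ]
      have hx0 : (0 : ℝ) < (1 / 2) ^ (d + 2) := by positivity
      have hx1 : ((1 : ℝ) / 2) ^ (d + 2) ≤ 1 / 4 := by
        calc ((1 : ℝ) / 2) ^ (d + 2) ≤ (1 / 2) ^ 2 :=
              pow_le_pow_of_le_one (by norm_num) (by norm_num) (by omega)
          _ = 1 / 4 := by norm_num
      have h1 : (1 / 2 : ℝ) ^ (d + 1 + 2) = (1 / 2) ^ (d + 2) / 2 := by ring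
      have h2 : (1 / 2 : ℝ) ^ (d + 1 + 1) = (1 / 2) ^ (d + 2) := rfl
      rw [h1, h2]
      set x := (1 / 2 : ℝ) ^ (d + 2)
      calc 1 / 4 + x / 2 ≤ (1 / 4 + x) * (1 - x) := by nlinarith
        _ ≤ _ := mul_le_mul_of_nonneg_right ih (by linarith)
  have key' : (1 / 4 : ℝ) ≤ ∏ j ∈ Finset.range d, (1 - (1 / 2 : ℝ) ^ (j + 1)) := by
    cases d with
    | zero => norm_num
    | succ d => exact le_trans (by have : (0 : ℝ) < (1 / 2) ^ (d + 2) := by positivity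
                                   linarith) (key d)
  have hprod : ((∏ i : Fin d, (q ^ d - q ^ (i : ℕ)) : ℕ) : ℝ) =
      (q : ℝ) ^ (d * d) * ∏ j ∈ Finset.range d, (1 - (1 / (q : ℝ)) ^ (j + 1)) := by
    rw [Fin.prod_univ_eq_prod_range (fun i => q ^ d - q ^ i) d, ← Finset.prod_range_reflect,
      Nat.cast_prod, pow_mul]
    have hconst : ((q : ℝ) ^ d) ^ d = ∏ _j ∈ Finset.range d, (q : ℝ) ^ d := by simp
    rw [hconst, ← Finset.prod_mul_distrib]
    refine Finset.prod_congr rfl fun j hj => ?_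
    have hj' := Finset.mem_range.1 hj
    have hle : q ^ (d - 1 - j) ≤ q ^ d := Nat.pow_le_pow_right (by omega) (by omega)
    have hsplit : (q : ℝ) ^ d = (q : ℝ) ^ (d - 1 - j) * (q : ℝ) ^ (j + 1) := by
      rw [← pow_add]
      congr 1
      omega
    rw [Nat.cast_sub hle, Nat.cast_pow, Nat.cast_pow, hsplit, one_div, inv_pow]
    field_simp
  have hmono : ∏ j ∈ Finset.range d, (1 - (1 / 2 : ℝ) ^ (j + 1)) ≤
      ∏ j ∈ Finset.range d, (1 - (1 / (q : ℝ)) ^ (j + 1)) := by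
    refine Finset.prod_le_prod (fun j _ => ?_) fun j _ => ?_
    · have : (1 / 2 : ℝ) ^ (j + 1) ≤ 1 := pow_le_one₀ (by norm_num) (by norm_num)
      linarith
    · have h2 : (2 : ℝ) ≤ q := by exact_mod_cast hq
      gcongr
  have : (q : ℝ) ^ (d * d) ≤ 4 * ((∏ i : Fin d, (q ^ d - q ^ (i : ℕ)) : ℕ) : ℝ) := by
    rw [hprod]
    have h3 : (0 : ℝ) < (q : ℝ) ^ (d * d) := by positivity
    nlinarith [key'.trans hmono]
  exact_mod_cast this

/-! ### Modules killed by `π`, as vector spaces over the residue field -/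

section Torsion

variable {R : Type*} [CommRing R] {π : R} {q : ℕ}
  {V : Type*} [AddCommGroup V] [Module R V]

theorem exists_card_eq_pow_of_smul_eq_zero [Finite V] (hmax : (Ideal.span {π}).IsMaximal)
    (hcard : Nat.card (R ⧸ Ideal.span {π}) = q) (hV : ∀ x : V, π • x = 0) :
    ∃ d, Nat.card V = q ^ d := by
  let := Ideal.Quotient.field (Ideal.span {π})
  let : Module (R ⧸ Ideal.span {π}) V := Module.IsTorsionBySet.module
    ((Module.isTorsionBySet_span_singleton_iff π).2 fun x => hV x)
  refine ⟨Module.finrank (R ⧸ Ideal.span {π}) V, ?_⟩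
  rw [Module.natCard_eq_pow_finrank (K := R ⧸ Ideal.span {π}), hcard]

/-- The spanning families of length `d` include the bases, which are as many as the elements of
`GL_d`; the span over `R` is the span over the residue field. -/
theorem pow_le_card_span_eq_top [Finite R] [Finite V]
    (hmax : (Ideal.span {π}).IsMaximal)
    (hcard : Nat.card (R ⧸ Ideal.span {π}) = q) (hV : ∀ x : V, π • x = 0) {d : ℕ}
    (hd : Nat.card V = q ^ d) :
    q ^ (d * d) ≤ 4 * Nat.card {v : Fin d → V // Submodule.span R (Set.range v) = ⊤} := by
  let := Ideal.Quotient.field (Ideal.span {π})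
  have htors := (Module.isTorsionBySet_span_singleton_iff π).2 fun x => hV x
  let : Module (R ⧸ Ideal.span {π}) V := Module.IsTorsionBySet.module htors
  have : IsScalarTower R (R ⧸ Ideal.span {π}) V := Module.IsTorsionBySet.isScalarTower htors
  have : Finite (R ⧸ Ideal.span {π}) :=
    Finite.of_surjective _ (Ideal.Quotient.mk_surjective (I := Ideal.span {π}))
  let := Fintype.ofFinite (R ⧸ Ideal.span {π})
  have hq : 1 < q := by
    rw [← hcard]
    exact Finite.one_lt_card
  have hrank : Module.finrank (R ⧸ Ideal.span {π}) V = d := by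
    have h1 := Module.natCard_eq_pow_finrank (K := R ⧸ Ideal.span {π}) (V := V)
    rw [hcard, hd] at h1
    exact (Nat.pow_right_injective hq h1).symm
  have hcount := card_linearIndependent (K := R ⧸ Ideal.span {π}) (V := V) (k := d) hrank.ge
  rw [hrank, ← Nat.card_eq_fintype_card, hcard] at hcount
  refine (pow_mul_self_le_four_mul_prod hq d).trans ?_
  rw [← hcount]
  refine Nat.mul_le_mul_left _ (Nat.card_le_card_of_injective
    (Subtype.map id fun v (hv : LinearIndependent _ v) => ?_)
    (Subtype.map_injective _ Function.injective_id))
  have h1 := hv.span_eq_top_of_card_eq_finrank' (by simp [hrank])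
  rw [← Submodule.restrictScalars_eq_top_iff R, Submodule.restrictScalars_span _ _
    (Ideal.Quotient.mk_surjective (I := Ideal.span {π}))] at h1
  exact h1

theorem exists_isCompl_of_smul_eq_zero (hmax : (Ideal.span {π}).IsMaximal)
    (hV : ∀ x : V, π • x = 0) (W : Submodule R V) :
    ∃ C : Submodule R V, IsCompl W C := by
  let := Ideal.Quotient.field (Ideal.span {π})
  have htors := (Module.isTorsionBySet_span_singleton_iff π).2 fun x => hV x
  have : IsSemisimpleModule R V := htors.isSemisimpleModule_iff.1 inferInstance
  exact exists_isCompl W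

/-- Take a spanning family of a complement of `W` and shift each of its `d` vectors by an arbitrary
element of `W`; all these families are distinct and generate `V` together with `W`. -/
theorem pow_le_card_span_sup_eq_top [Finite R] [Finite V]
    (hmax : (Ideal.span {π}).IsMaximal)
    (hcard : Nat.card (R ⧸ Ideal.span {π}) = q) (hV : ∀ x : V, π • x = 0) (W : Submodule R V)
    {w d : ℕ} (hW : Nat.card W = q ^ w) (hd : Nat.card V = q ^ (w + d)) :
    q ^ ((w + d) * d) ≤
      4 * Nat.card {v : Fin d → V // Submodule.span R (Set.range v) ⊔ W = ⊤} := by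
  obtain ⟨C, hC⟩ := exists_isCompl_of_smul_eq_zero hmax hV W
  have hq : 0 < q := by
    rw [← hcard]
    have : Finite (R ⧸ Ideal.span {π}) :=
      Finite.of_surjective _ (Ideal.Quotient.mk_surjective (I := Ideal.span {π}))
    exact Nat.card_pos
  have hcardC : Nat.card C = q ^ d := by
    have h1 : Nat.card W * Nat.card C = Nat.card V := by
      rw [← Nat.card_prod]
      exact Nat.card_congr (Submodule.prodEquivOfIsCompl W C hC).toEquiv
    rw [hW, hd, pow_add] at h1
    exact Nat.eq_of_mul_eq_mul_left (by positivity) h1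
  have hcount := pow_le_card_span_eq_top hmax hcard (V := C)
    (fun x => Subtype.ext (hV x)) hcardC
  calc q ^ ((w + d) * d) = (q ^ w) ^ d * q ^ (d * d) := by rw [← pow_mul, ← pow_add]; ring_nf
    _ ≤ (q ^ w) ^ d * (4 * _) := Nat.mul_le_mul_left _ hcount
    _ = 4 * Nat.card ((Fin d → W) × {v : Fin d → C // Submodule.span R (Set.range v) = ⊤}) := by
      rw [Nat.card_prod, Nat.card_fun, hW, Nat.card_eq_fintype_card (α := Fin d), Fintype.card_fin]
      ring
    _ ≤ _ := ?_
  refine Nat.mul_le_mul_left _ (Nat.card_le_card_of_injective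
    (fun p => ⟨fun i => (p.1 i : V) + p.2.1 i, ?_⟩) ?_)
  · rw [eq_top_iff, ← hC.sup_eq_top]
    refine sup_le le_sup_right ?_
    have h1 : C = Submodule.span R (Set.range fun i => (p.2.1 i : V)) := by
      have h2 := congrArg (Submodule.map C.subtype) p.2.2
      rw [Submodule.map_span, Submodule.map_top, Submodule.range_subtype, ← Set.range_comp] at h2
      exact h2.symm
    refine h1.le.trans (Submodule.span_le.2 ?_)
    rintro _ ⟨i, rfl⟩
    have h3 : (p.2.1 i : V) = ((p.1 i : V) + p.2.1 i) - p.1 i := by abel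
    change (p.2.1 i : V) ∈ _
    rw [h3]
    exact Submodule.sub_mem _ (Submodule.mem_sup_left (Submodule.subset_span ⟨i, rfl⟩))
      (Submodule.mem_sup_right (p.1 i).2)
  · rintro ⟨a, c⟩ ⟨a', c'⟩ h
    have h1 : ∀ i, (a i : V) + c.1 i = a' i + c'.1 i := fun i => congrFun (congrArg Subtype.val h) i
    have h2 : ∀ i, (a i, c.1 i) = (a' i, c'.1 i) := fun i =>
      (Submodule.prodEquivOfIsCompl W C hC).injective (by simpa using h1 i)
    refine Prod.ext (funext fun i => (Prod.ext_iff.1 (h2 i)).1) (Subtype.ext (funext fun i => ?_))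
    exact (Prod.ext_iff.1 (h2 i)).2

end Torsion

/-! ### Counting submodules through multiplication by `π` -/

section Kernel

variable {R : Type*} [CommRing R] {π : R} {X : Type*} [AddCommGroup X] [Module R X]

/-- First isomorphism theorem for multiplication by `π` on `U`. -/
theorem card_inf_torsionBy_mul_card_smul (U : Submodule R X) :
    Nat.card ↥(U ⊓ Submodule.torsionBy R X π) * Nat.card ↥(π • U) = Nat.card U := by
  let f : U →ₗ[R] X := (LinearMap.lsmul R X π).domRestrict U
  rw [Submodule.card_eq_card_quotient_mul_card (LinearMap.ker f)]
  congr 1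
  · refine Nat.card_congr
      { toFun := fun x => ⟨⟨x.1, x.2.1⟩, x.2.2⟩
        invFun := fun x => ⟨x.1.1, x.1.2, x.2⟩
        left_inv := fun x => rfl
        right_inv := fun x => rfl }
  · rw [Nat.card_congr f.quotKerEquivRange.toEquiv]
    have : LinearMap.range f = π • U := LinearMap.range_domRestrict _ _
    rw [this]

theorem card_smul_eq_of_mem (U : Submodule R X) {y : X} (hy : y ∈ π • U) :
    Nat.card {x // x ∈ U ∧ π • x = y} = Nat.card ↥(U ⊓ Submodule.torsionBy R X π) := by
  obtain ⟨x₀, hx₀, rfl⟩ := (Submodule.mem_smul_pointwise_iff_exists _ _ _).1 hy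
  exact Nat.card_congr
    { toFun := fun x => ⟨x.1 - x₀, U.sub_mem x.2.1 hx₀, by
        simp [smul_sub, x.2.2]⟩
      invFun := fun z => ⟨z.1 + x₀, U.add_mem z.2.1 hx₀, by
        have : π • z.1 = 0 := z.2.2
        rw [smul_add, this, zero_add]⟩
      left_inv := fun x => by simp
      right_inv := fun z => by simp }

theorem card_smul_eq_le [Finite X] (U : Submodule R X) (y : X) :
    Nat.card {x // x ∈ U ∧ π • x = y} ≤ Nat.card ↥(U ⊓ Submodule.torsionBy R X π) := by
  by_cases hy : y ∈ π • U
  · exact (card_smul_eq_of_mem U hy).le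
  · have : IsEmpty {x // x ∈ U ∧ π • x = y} :=
      ⟨fun x => hy ((Submodule.mem_smul_pointwise_iff_exists _ _ _).2 ⟨x.1, x.2⟩)⟩
    simp

/-- Over a finite chain ring, a finite module is generated by as many elements as the dimension of
its `π`-torsion. -/
theorem exists_span_range_eq_top_of_card_torsionBy [Finite X] {q s : ℕ}
    (hR : IsFiniteChainRing R π q s) {d : ℕ}
    (hd : Nat.card (Submodule.torsionBy R X π) = q ^ d) :
    ∃ g : Fin d → X, Submodule.span R (Set.range g) = ⊤ := by
  have := hR.isLocalRing
  have := hR.finite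
  -- Kernel and cokernel of multiplication by `π` on a finite module have the same size, so `C` has
  -- dimension `d`; its generators lift by Nakayama's lemma.
  let C := X ⧸ (π • (⊤ : Submodule R X))
  have hC : ∀ x : C, π • x = 0 := by
    intro x
    obtain ⟨y, rfl⟩ := Submodule.Quotient.mk_surjective _ x
    rw [← Submodule.Quotient.mk_smul, Submodule.Quotient.mk_eq_zero]
    exact Submodule.smul_mem_pointwise_smul _ _ _ trivial
  have hcardC : Nat.card C = q ^ d := by
    have h1 := Submodule.card_eq_card_quotient_mul_card (π • (⊤ : Submodule R X))
    have h2 := card_inf_torsionBy_mul_card_smul (π := π) (⊤ : Submodule R X)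
    rw [top_inf_eq, hd, Nat.card_congr Submodule.topEquiv.toEquiv, h1, mul_comm] at h2
    exact (Nat.eq_of_mul_eq_mul_left Nat.card_pos h2).symm
  have hq := hR.one_lt_residue_card
  have : Finite C := Finite.of_surjective _ (Submodule.Quotient.mk_surjective _)
  have hpos := pow_le_card_span_eq_top hR.maximal hR.residue_card hC hcardC
  have hne : Nat.card {v : Fin d → C // Submodule.span R (Set.range v) = ⊤} ≠ 0 := by
    intro h0
    rw [h0, mul_zero] at hpos
    exact absurd hpos (by have : 0 < q ^ (d * d) := by positivity
                          omega)
  obtain ⟨⟨v, hv⟩⟩ := (Nat.card_ne_zero.1 hne).1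
  choose g hg using fun i => Submodule.Quotient.mk_surjective _ (v i)
  refine ⟨g, eq_top_iff.2 ?_⟩
  refine Submodule.le_of_le_smul_of_le_jacobson_bot (I := Ideal.span {π}) Module.Finite.fg_top
    ?_ ?_
  · rw [IsLocalRing.jacobson_eq_maximalIdeal _ bot_ne_top, IsLocalRing.eq_maximalIdeal hR.maximal]
  · rw [Submodule.ideal_span_singleton_smul]
    have h1 : Submodule.map (π • (⊤ : Submodule R X)).mkQ (Submodule.span R (Set.range g)) = ⊤ := by
      rw [Submodule.map_span, ← Set.range_comp, ← hv]
      congr 2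
      exact funext hg
    have h2 := congrArg (Submodule.comap (π • (⊤ : Submodule R X)).mkQ) h1
    rw [Submodule.comap_map_mkQ, Submodule.comap_top] at h2
    rw [sup_comm, h2]

/-- A submodule generated by `n` elements has `π`-torsion of dimension at most `n`. -/
theorem card_inf_torsionBy_le_of_span [Finite X] {q s : ℕ} (hR : IsFiniteChainRing R π q s) {n : ℕ}
    (g : Fin n → X) :
    Nat.card ↥(Submodule.span R (Set.range g) ⊓ Submodule.torsionBy R X π) ≤ q ^ n := by
  set U := Submodule.span R (Set.range g) with hU
  have := hR.finite
  have hgU : ∀ i, g i ∈ U := fun i => Submodule.subset_span ⟨i, rfl⟩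
  have hπU : π • U ≤ U := by
    intro x hx
    obtain ⟨y, hy, rfl⟩ := (Submodule.mem_smul_pointwise_iff_exists _ _ _).1 hx
    exact U.smul_mem _ hy
  -- Modulo `πU` only the residues of the coefficients matter, so `|U| ≤ q ^ n * |πU|`, while `|U| =
  -- |U ∩ T| * |πU|`.
  let F : (Fin n → R ⧸ Ideal.span {π}) × ↥(π • U) → U := fun p =>
    ⟨∑ i, (p.1 i).out • g i + p.2.1,
      U.add_mem (U.sum_mem fun i _ => U.smul_mem _ (hgU i)) (hπU p.2.2)⟩
  have hF : Function.Surjective F := by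
    rintro ⟨x, hx⟩
    obtain ⟨c, rfl⟩ := (Submodule.mem_span_range_iff_exists_fun R).1 hx
    have h1 : ∀ i, ∃ e, c i - (Ideal.Quotient.mk (Ideal.span {π}) (c i)).out = π * e := by
      intro i
      have : Ideal.Quotient.mk (Ideal.span {π})
          (c i - (Ideal.Quotient.mk (Ideal.span {π}) (c i)).out) = 0 := by
        rw [map_sub, Ideal.Quotient.mk_out, sub_self]
      exact Ideal.mem_span_singleton.1 (Ideal.Quotient.eq_zero_iff_mem.1 this)
    choose e he using h1
    refine ⟨⟨fun i => Ideal.Quotient.mk _ (c i), ⟨π • ∑ i, e i • g i,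
      Submodule.smul_mem_pointwise_smul _ _ _ (U.sum_mem fun i _ => U.smul_mem _ (hgU i))⟩⟩, ?_⟩
    refine Subtype.ext ?_
    simp only [F]
    rw [Finset.smul_sum, ← Finset.sum_add_distrib]
    refine Finset.sum_congr rfl fun i _ => ?_
    rw [smul_smul, ← he, ← add_smul, add_sub_cancel]
  have : Finite (R ⧸ Ideal.span {π}) :=
    Finite.of_surjective _ (Ideal.Quotient.mk_surjective (I := Ideal.span {π}))
  have h1 := Nat.card_le_card_of_surjective F hF
  rw [Nat.card_prod, Nat.card_fun, hR.residue_card, Nat.card_eq_fintype_card (α := Fin n),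
    Fintype.card_fin, ← card_inf_torsionBy_mul_card_smul (π := π) U] at h1
  exact Nat.le_of_mul_le_mul_right h1 Nat.card_pos

/-- A submodule is generated by its `π`-torsion and by preimages of generators of its multiple by
`π`. -/
theorem eq_span_sup_inf_torsionBy {ι : Type*} (U : Submodule R X) {g u : ι → X}
    (hg : Submodule.span R (Set.range g) = π • U) (hu : ∀ k, u k ∈ U ∧ π • u k = g k) :
    U = Submodule.span R (Set.range u) ⊔ (U ⊓ Submodule.torsionBy R X π) := by
  refine le_antisymm (fun x hx => ?_) (sup_le (Submodule.span_le.2 ?_) inf_le_left)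
  · have h1 : π • x ∈ (LinearMap.lsmul R X π : X →ₗ[R] X) '' Submodule.span R (Set.range u) := by
      rw [← Submodule.map_coe, Submodule.map_span, ← Set.range_comp]
      have : (LinearMap.lsmul R X π : X →ₗ[R] X) ∘ u = g := funext fun k => (hu k).2
      rw [this, hg]
      exact Submodule.smul_mem_pointwise_smul _ _ _ hx
    obtain ⟨y, hy, hyx⟩ := h1
    have hyU : y ∈ U := (Submodule.span_le.2 (by rintro _ ⟨k, rfl⟩; exact (hu k).1)) hy
    have h2 : x = y + (x - y) := by abel
    rw [h2]
    refine Submodule.add_mem _ (Submodule.mem_sup_left hy) (Submodule.mem_sup_right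
      ⟨U.sub_mem hx hyU, ?_⟩)
    have h3 : π • y = π • x := hyx
    exact (Submodule.mem_torsionBy_iff _ _).2 (by rw [smul_sub, h3, sub_self])
  · rintro _ ⟨k, rfl⟩
    exact (hu k).1

/-- The number of submodules with given multiple by `π` and given dimension of the `π`-torsion. -/
theorem ncard_submodule_fiber_mul_le [Finite X] {q s : ℕ} (hR : IsFiniteChainRing R π q s)
    (M U' : Submodule R X) {a l : ℕ}
    (ha : Nat.card ↥(M ⊓ Submodule.torsionBy R X π) ≤ q ^ a) :
    {U : Submodule R X | U ≤ M ∧ π • U = U' ∧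
      Nat.card ↥(U ⊓ Submodule.torsionBy R X π) = q ^ l}.ncard * q ^ (l * l) ≤
      4 * q ^ (a * l) := by
  classical
  set T := Submodule.torsionBy R X π with hT
  set S := {U : Submodule R X | U ≤ M ∧ π • U = U' ∧ Nat.card ↥(U ⊓ T) = q ^ l} with hS
  have := hR.finite
  have hq := hR.one_lt_residue_card
  rcases S.eq_empty_or_nonempty with h0 | ⟨U₀, hU₀⟩
  · simp [h0]
  have hkill : ∀ U : Submodule R X, ∀ x : ↥(U ⊓ T), π • x = 0 := fun U x => Subtype.ext x.2.2
  obtain ⟨w, hw⟩ := exists_card_eq_pow_of_smul_eq_zero hR.maximal hR.residue_card (hkill U')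
  have hsub : ∀ U ∈ S, U' ⊓ T ≤ U ⊓ T := by
    rintro U ⟨-, rfl, -⟩
    refine inf_le_inf_right _ fun x hx => ?_
    obtain ⟨y, hy, rfl⟩ := (Submodule.mem_smul_pointwise_iff_exists _ _ _).1 hx
    exact U.smul_mem _ hy
  obtain ⟨d, rfl⟩ : ∃ d, l = w + d := by
    have h1 : Nat.card ↥(U' ⊓ T) ≤ Nat.card ↥(U₀ ⊓ T) :=
      Nat.card_mono (Set.toFinite _) (hsub U₀ hU₀)
    rw [hU₀.2.2, hw] at h1
    exact Nat.exists_eq_add_of_le ((Nat.pow_le_pow_iff_right hq).1 h1)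
  obtain ⟨g, hg⟩ : ∃ g : Fin w → X, Submodule.span R (Set.range g) = U' := by
    have h1 : Nat.card (Submodule.torsionBy R U' π) = q ^ w := by
      rw [← hw]
      exact Nat.card_congr
        { toFun := fun x => ⟨x.1.1, x.1.2, congrArg Subtype.val x.2⟩
          invFun := fun x => ⟨⟨x.1, x.2.1⟩, Subtype.ext x.2.2⟩
          left_inv := fun x => rfl
          right_inv := fun x => rfl }
    obtain ⟨g, hg⟩ := exists_span_range_eq_top_of_card_torsionBy hR h1
    refine ⟨fun i => g i, ?_⟩
    have h2 := congrArg (Submodule.map U'.subtype) hg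
    rw [Submodule.map_span, Submodule.map_top, Submodule.range_subtype, ← Set.range_comp] at h2
    exact h2
  -- Double counting. The data attached to `U` are preimages in `U` of fixed generators of `U'`, and
  -- `d` torsion vectors completing `U' ∩ T` to `U ∩ T`. Each `U` has at least `q ^ (l * l) / 4` of
  -- them, they determine `U` (`hrec`), and `M` contains at most `q ^ (a * l)` in all.
  let A : S → Type _ := fun U =>
    ((k : Fin w) → {x // x ∈ U.1 ∧ π • x = g k}) ×
      {v : Fin d → ↥(U.1 ⊓ T) // Submodule.span R (Set.range v) ⊔
        (U' ⊓ T).comap (U.1 ⊓ T).subtype = ⊤}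
  have hA : ∀ U : S, q ^ ((w + d) * (w + d)) ≤ 4 * Nat.card (A U) := by
    intro U
    have h1 : Nat.card ((k : Fin w) → {x // x ∈ U.1 ∧ π • x = g k}) = (q ^ (w + d)) ^ w := by
      rw [Nat.card_pi, Finset.prod_congr rfl fun k _ => ?_, Finset.prod_const, Finset.card_univ,
        Fintype.card_fin]
      rw [card_smul_eq_of_mem, U.2.2.2]
      rw [U.2.2.1, ← hg]
      exact Submodule.subset_span ⟨k, rfl⟩
    have h2 : Nat.card ((U' ⊓ T).comap (U.1 ⊓ T).subtype) = q ^ w := by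
      rw [← hw]
      exact Nat.card_congr (Submodule.comapSubtypeEquivOfLe (hsub U.1 U.2)).toEquiv
    have h3 := pow_le_card_span_sup_eq_top hR.maximal hR.residue_card (hkill U.1) _ h2 U.2.2.2
    rw [Nat.card_prod, h1]
    calc q ^ ((w + d) * (w + d)) = (q ^ (w + d)) ^ w * q ^ ((w + d) * d) := by
          rw [← pow_mul, ← pow_add]; ring_nf
      _ ≤ (q ^ (w + d)) ^ w * (4 * _) := Nat.mul_le_mul_left _ h3
      _ = _ := by ring
  let Φ : (Σ U : S, A U) →
      ((k : Fin w) → {x // x ∈ M ∧ π • x = g k}) × (Fin d → ↥(M ⊓ T)) := fun p =>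
    (fun k => ⟨(p.2.1 k).1, p.1.2.1 (p.2.1 k).2.1, (p.2.1 k).2.2⟩,
      fun j => ⟨(p.2.2.1 j).1, p.1.2.1 (p.2.2.1 j).2.1, (p.2.2.1 j).2.2⟩)
  have hrec : ∀ (U : S) (x : A U), U.1 = Submodule.span R (Set.range fun k => (x.1 k).1) ⊔
      (Submodule.span R (Set.range fun j => (x.2.1 j).1) ⊔ U' ⊓ T) := by
    intro U x
    have h1 : U.1 ⊓ T = Submodule.span R (Set.range fun j => (x.2.1 j).1) ⊔ U' ⊓ T := by
      have h2 := congrArg (Submodule.map (U.1 ⊓ T).subtype) x.2.2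
      rw [Submodule.map_sup, Submodule.map_span, Submodule.map_top, Submodule.range_subtype,
        ← Set.range_comp, Submodule.map_comap_subtype, inf_eq_right.2 (hsub U.1 U.2)] at h2
      exact h2.symm
    rw [← h1]
    exact eq_span_sup_inf_torsionBy U.1 (hg.trans U.2.2.1.symm) fun k => (x.1 k).2
  have hΦ : Function.Injective Φ := by
    rintro ⟨U, x⟩ ⟨V, y⟩ h
    have h1 : ∀ k, (x.1 k).1 = (y.1 k).1 := fun k =>
      congrArg Subtype.val (congrFun (congrArg Prod.fst h) k)
    have h2 : ∀ j, (x.2.1 j).1 = (y.2.1 j).1 := fun j =>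
      congrArg Subtype.val (congrFun (congrArg Prod.snd h) j)
    have hUV : U = V := by
      refine Subtype.ext ?_
      rw [hrec U x, hrec V y]
      simp only [h1, h2]
    subst hUV
    refine congrArg (Sigma.mk U) (Prod.ext (funext fun k => Subtype.ext (h1 k))
      (Subtype.ext (funext fun j => Subtype.ext (h2 j))))
  have hfin : Finite S := Subtype.finite
  let _ := Fintype.ofFinite S
  have hcardΦ := Nat.card_le_card_of_injective Φ hΦ
  rw [Nat.card_sigma] at hcardΦ
  have hright : Nat.card (((k : Fin w) → {x // x ∈ M ∧ π • x = g k}) × (Fin d → ↥(M ⊓ T))) ≤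
      q ^ (a * (w + d)) := by
    rw [Nat.card_prod, Nat.card_pi, Nat.card_fun, Nat.card_eq_fintype_card (α := Fin d),
      Fintype.card_fin, mul_add, pow_add, pow_mul, pow_mul]
    refine Nat.mul_le_mul ?_ (Nat.pow_le_pow_left ha d)
    calc _ ≤ ∏ _k : Fin w, q ^ a :=
          Finset.prod_le_prod' fun k _ => (card_smul_eq_le M (g k)).trans ha
      _ = _ := by simp
  calc S.ncard * q ^ ((w + d) * (w + d)) = ∑ _U : S, q ^ ((w + d) * (w + d)) := by
        rw [Finset.sum_const, Finset.card_univ, smul_eq_mul, ← Nat.card_eq_fintype_card]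
        rfl
    _ ≤ ∑ U : S, 4 * Nat.card (A U) := Finset.sum_le_sum fun U _ => hA U
    _ = 4 * ∑ U : S, Nat.card (A U) := by rw [Finset.mul_sum]
    _ ≤ _ := Nat.mul_le_mul_left _ (hcardΦ.trans hright)

/-- With `k = min n (a / 2)` and `c = a - k`, the claim is `(k - l) * (c - l) ≥ 0`. No integer `l ≤
n` lies strictly between `k` and `c`: either `k = n`, or `c - k ≤ 1`. -/
theorem mul_le_min_half_mul_add_sq {n a l : ℕ} (hl : l ≤ n) :
    a * l ≤ min n (a / 2) * (a - min n (a / 2)) + l * l := by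
  obtain ⟨c, hc⟩ := Nat.exists_eq_add_of_le ((min_le_right n (a / 2)).trans (Nat.div_le_self a 2))
  set k := min n (a / 2) with hk
  have h1 : a - k = c := by omega
  rw [h1, hc]
  have h2 : l ≤ k ∧ l ≤ c ∨ k ≤ l ∧ c ≤ l := by
    rcases le_or_gt n (a / 2) with h | h
    · rw [min_eq_left h] at hk
      omega
    · rw [min_eq_right h.le] at hk
      omega
  zify at h2 ⊢
  rcases h2 with ⟨h3, h4⟩ | ⟨h3, h4⟩ <;> nlinarith

/-- The number of submodules with `π`-torsion of dimension at most `l`, inside a module with given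
dimensions of the `π`-torsion of its multiples. -/
theorem ncard_submodule_le [Finite X] {q s : ℕ} (hR : IsFiniteChainRing R π q s) (n t : ℕ) :
    ∀ (M : Submodule R X) (a : ℕ → ℕ),
      (∀ i, Nat.card ↥((π ^ i • M) ⊓ Submodule.torsionBy R X π) ≤ q ^ a i) →
      π ^ t • M = ⊥ → ∀ l ≤ n,
      {U : Submodule R X | U ≤ M ∧ Nat.card ↥(U ⊓ Submodule.torsionBy R X π) ≤ q ^ l}.ncard ≤
        4 ^ t * (l + t).choose t *
          q ^ ∑ i ∈ Finset.range t, min n (a i / 2) * (a i - min n (a i / 2)) := by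
  classical
  have hq := hR.one_lt_residue_card
  induction t with
  | zero =>
    intro M a _ hM l _
    rw [pow_zero, one_smul] at hM
    subst hM
    simp only [pow_zero, Nat.choose_zero_right, mul_one, Finset.range_zero, Finset.sum_empty]
    refine (Set.ncard_le_ncard (t := {⊥}) ?_).trans (Set.ncard_singleton _).le
    rintro U ⟨hU, -⟩
    exact le_bot_iff.1 hU
  | succ t ih =>
    intro M a ha hM l hl
    set T := Submodule.torsionBy R X π with hT
    let _ := Fintype.ofFinite (Submodule R X)
    have hπ : ∀ i, π ^ i • π • M = π ^ (i + 1) • M := fun i => by rw [smul_smul, pow_succ]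
    have ih' := ih (π • M) (fun i => a (i + 1)) (fun i => by rw [hπ]; exact ha _)
      (by rw [hπ]; exact hM)
    set E := ∑ i ∈ Finset.range t,
      min n (a (i + 1) / 2) * (a (i + 1) - min n (a (i + 1) / 2)) with hE
    set E₀ := min n (a 0 / 2) * (a 0 - min n (a 0 / 2)) with hE₀
    let small : Submodule R X → ℕ → Finset (Submodule R X) := fun M l =>
      {U | U ≤ M ∧ Nat.card ↥(U ⊓ T) ≤ q ^ l}
    let fiber : Submodule R X → ℕ → Finset (Submodule R X) := fun U' l =>
      {U | U ≤ M ∧ π • U = U' ∧ Nat.card ↥(U ⊓ T) = q ^ l}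
    have hsmall : ∀ M l, {U : Submodule R X | U ≤ M ∧ Nat.card ↥(U ⊓ T) ≤ q ^ l}.ncard =
        (small M l).card := by
      intro M l
      rw [← Set.ncard_coe_finset]
      simp [small]
    have hfiber : ∀ U', ∀ l ≤ n, (fiber U' l).card ≤ 4 * q ^ E₀ := by
      intro U' l hl
      have h1 := ncard_submodule_fiber_mul_le hR M U' (a := a 0) (l := l) (by simpa only [pow_zero, one_smul] using ha 0)
      have h2 : {U : Submodule R X | U ≤ M ∧ π • U = U' ∧ Nat.card ↥(U ⊓ T) = q ^ l}.ncard =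
          (fiber U' l).card := by
        rw [← Set.ncard_coe_finset]
        simp [fiber]
      rw [h2] at h1
      have h3 : q ^ (a 0 * l) ≤ q ^ (E₀ + l * l) :=
        Nat.pow_le_pow_right (by omega) (mul_le_min_half_mul_add_sq hl)
      rw [pow_add] at h3
      refine Nat.le_of_mul_le_mul_right (c := q ^ (l * l)) ?_ (by positivity)
      calc _ ≤ 4 * q ^ (a 0 * l) := h1
        _ ≤ 4 * (q ^ E₀ * q ^ (l * l)) := Nat.mul_le_mul_left _ h3
        _ = _ := by ring
    -- Sort `U` by the exact dimension `l₀` of its torsion and by `πU`. As `πU ≤ U`, the induction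
    -- hypothesis applies to `πU` with `l₀` in place of `l`; summing `(l₀ + t choose t)` over `l₀ ≤
    -- l` then gives the next binomial coefficient.
    have hcover : small M l ⊆
        (Finset.range (l + 1)).biUnion fun l₀ => (small (π • M) l₀).biUnion fun U' =>
          fiber U' l₀ := by
      intro U hU
      obtain ⟨hUM, hUl⟩ := (Finset.mem_filter.1 hU).2
      obtain ⟨l₀, hl₀⟩ := exists_card_eq_pow_of_smul_eq_zero hR.maximal hR.residue_card
        (V := ↥(U ⊓ T)) fun x => Subtype.ext x.2.2
      have hπU : π • U ≤ U := by
        intro x hx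
        obtain ⟨y, hy, rfl⟩ := (Submodule.mem_smul_pointwise_iff_exists _ _ _).1 hx
        exact U.smul_mem _ hy
      refine Finset.mem_biUnion.2 ⟨l₀, ?_, Finset.mem_biUnion.2 ⟨π • U, ?_, ?_⟩⟩
      · rw [hl₀] at hUl
        have := (Nat.pow_le_pow_iff_right hq).1 hUl
        exact Finset.mem_range.2 (by omega)
      · refine Finset.mem_filter.2 ⟨Finset.mem_univ _, Submodule.map_mono hUM, ?_⟩
        rw [← hl₀]
        exact Nat.card_mono (Set.toFinite _) (inf_le_inf_right _ hπU : π • U ⊓ T ≤ U ⊓ T)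
      · exact Finset.mem_filter.2 ⟨Finset.mem_univ _, hUM, rfl, hl₀⟩
    rw [hsmall]
    calc (small M l).card ≤ _ := Finset.card_le_card hcover
      _ ≤ ∑ l₀ ∈ Finset.range (l + 1), 4 ^ t * (l₀ + t).choose t * q ^ E * (4 * q ^ E₀) := by
        refine Finset.card_biUnion_le.trans (Finset.sum_le_sum fun l₀ hl₀ => ?_)
        have hl₀' : l₀ ≤ n := by
          have := Finset.mem_range.1 hl₀
          omega
        refine (Finset.card_biUnion_le_card_mul _ _ _ fun U' _ => hfiber U' l₀ hl₀').trans ?_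
        refine Nat.mul_le_mul_right _ ?_
        rw [← hsmall]
        exact ih' l₀ hl₀'
      _ = 4 ^ (t + 1) * (l + (t + 1)).choose (t + 1) *
          q ^ ∑ i ∈ Finset.range (t + 1), min n (a i / 2) * (a i - min n (a i / 2)) := by
        rw [Finset.sum_range_succ' (fun i => min n (a i / 2) * (a i - min n (a i / 2))), ← hE, ← hE₀, ← add_assoc, ← Nat.sum_range_add_choose,
          Finset.mul_sum, Finset.sum_mul]
        refine Finset.sum_congr rfl fun i _ => ?_
        rw [pow_add, pow_succ]
        ring

end Kernel

/-! ### The number of row spans of matrices with rows in `R^μ` -/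

/-- The sublevel set of a monotone sequence is an initial segment. This turns the exponents in
`shapeModule` and `pivotExponent` into inequalities between parts. -/
theorem lt_card_filter_le_iff {s : ℕ} {κ : Fin s → ℕ} (hκ : Monotone κ) (t : Fin s) (k : ℕ) :
    (t : ℕ) < (Finset.univ.filter fun i => κ i ≤ k).card ↔ κ t ≤ k := by
  constructor
  · intro h
    by_contra hlt
    have : (Finset.univ.filter fun i => κ i ≤ k) ⊆ Finset.Iio t := by
      intro i hi
      rw [Finset.mem_Iio]
      by_contra h'
      exact hlt ((hκ (not_lt.1 h')).trans (Finset.mem_filter.1 hi).2)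
    have := Finset.card_le_card this
    rw [Fin.card_Iio] at this
    omega
  · intro h
    have : Finset.Iic t ⊆ (Finset.univ.filter fun i => κ i ≤ k) := fun i hi =>
      Finset.mem_filter.2 ⟨Finset.mem_univ _, (hκ (Finset.mem_Iic.1 hi)).trans h⟩
    have := Finset.card_le_card this
    rw [Fin.card_Iic] at this
    omega

theorem le_packetLength {s : ℕ} (μ : Shape s) (i : Fin s) : μ i ≤ packetLength μ :=
  Finset.le_sup (f := μ) (Finset.mem_univ i)

section RowSpans

variable {R : Type*} [CommRing R] {π : R} {q s : ℕ}

theorem card_torsionBy_self [Finite R] (hR : IsFiniteChainRing R π q s) :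
    Nat.card (Submodule.torsionBy R R π) = q := by
  have h1 := card_inf_torsionBy_mul_card_smul (π := π) (⊤ : Submodule R R)
  have h2 : π • (⊤ : Submodule R R) = Ideal.span {π} := by
    rw [← Submodule.ideal_span_singleton_smul]
    simp
  have h3 := Submodule.card_eq_card_quotient_mul_card (Ideal.span {π} : Submodule R R)
  rw [top_inf_eq, h2, Nat.card_congr Submodule.topEquiv.toEquiv, h3, mul_comm] at h1
  rw [← hR.residue_card]
  exact Nat.eq_of_mul_eq_mul_left Nat.card_pos h1

/-- Elements of `π ^ i • R^μ` vanish in every coordinate `j ≥ μ_{s-i}`, where `i` plus the exponent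
of the coordinate reaches `s`. Each remaining coordinate of a torsion element lies in the
annihilator of `π`, which has `q` elements. The reversal of `i` reflects that the largest part
survives in layer `0`. -/
theorem card_smul_shapeModule_inf_torsionBy_le [Finite R] (hR : IsFiniteChainRing R π q s) (μ : Shape s)
    (i : ℕ) :
    Nat.card ↥((π ^ i • shapeModule π μ) ⊓ Submodule.torsionBy R (Fin (packetLength μ) → R) π) ≤
      q ^ (if h : i < s then μ (Fin.rev ⟨i, h⟩) else 0) := by
  set a := if h : i < s then μ (Fin.rev ⟨i, h⟩) else 0 with ha
  have ham : a ≤ packetLength μ := by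
    rw [ha]
    split_ifs
    · exact le_packetLength _ _
    · exact Nat.zero_le _
  have hzero : ∀ x ∈ π ^ i • shapeModule π μ, ∀ j : Fin (packetLength μ), a ≤ j → x j = 0 := by
    intro x hx j hj
    obtain ⟨y, hy, rfl⟩ := (Submodule.mem_smul_pointwise_iff_exists _ _ _).1 hx
    obtain ⟨c, hc⟩ := Ideal.mem_span_singleton.1 (Submodule.mem_pi.1 hy j trivial)
    have hs : s ≤ i + (Finset.univ.filter fun i : Fin s => μ i ≤ (j : ℕ)).card := by
      by_cases h : i < s
      · rw [dif_pos h] at ha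
        rw [ha] at hj
        have := (lt_card_filter_le_iff μ.monotone _ _).2 hj
        rw [Fin.val_rev] at this
        dsimp only at this
        omega
      · omega
    rw [Pi.smul_apply, hc, smul_eq_mul, ← mul_assoc, ← pow_add,
      pow_eq_zero_of_le hs hR.pow_length, zero_mul]
  have hcard : Nat.card (Fin a → Submodule.torsionBy R R π) = q ^ a := by
    rw [Nat.card_fun, card_torsionBy_self hR, Nat.card_eq_fintype_card (α := Fin a),
      Fintype.card_fin]
  rw [← hcard]
  refine Nat.card_le_card_of_injective
    (fun x j => ⟨x.1 (Fin.castLE ham j), congrFun x.2.2 (Fin.castLE ham j)⟩) fun x y hxy => ?_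
  refine Subtype.ext (funext fun j => ?_)
  rcases lt_or_ge (j : ℕ) a with h | h
  · exact congrArg Subtype.val (congrFun hxy ⟨j, h⟩)
  · rw [hzero _ x.2.1 j h, hzero _ y.2.1 j h]

/-- The number of row spans is at most `4 ^ s * (n + s choose s)` times the main term. -/
theorem ncard_range_rowSpan_le [Finite R] (hR : IsFiniteChainRing R π q s) (n : ℕ) (μ : Shape s) :
    (Set.range fun X : RowMatrix π n μ => rowSpan X.1).ncard ≤
      4 ^ s * (n + s).choose s * q ^ ∑ i, kappa n μ i * (μ i - kappa n μ i) := by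
  set a : ℕ → ℕ := fun i => if h : i < s then μ (Fin.rev ⟨i, h⟩) else 0 with ha
  have hbot : π ^ s • shapeModule π μ = ⊥ := by
    rw [hR.pow_length]
    exact zero_smul _ _
  have h1 := ncard_submodule_le hR n s (shapeModule π μ) a
    (card_smul_shapeModule_inf_torsionBy_le hR μ) hbot n le_rfl
  have hsum : ∑ i ∈ Finset.range s, min n (a i / 2) * (a i - min n (a i / 2)) =
      ∑ i, kappa n μ i * (μ i - kappa n μ i) := by
    rw [← Fin.sum_univ_eq_sum_range (fun i => min n (a i / 2) * (a i - min n (a i / 2))),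
      ← Equiv.sum_comp Fin.revPerm]
    refine Finset.sum_congr rfl fun i _ => ?_
    have hai : a (Fin.revPerm i : Fin s) = μ i := by
      simp only [ha]
      rw [dif_pos (Fin.revPerm i).2, Fin.eta, Fin.revPerm_apply, Fin.rev_rev]
    rw [hai, kappa]
  rw [← hsum]
  refine le_trans (Set.ncard_le_ncard ?_ (Set.toFinite _)) h1
  rintro _ ⟨X, rfl⟩
  exact ⟨Submodule.span_le.2 (by rintro _ ⟨i, rfl⟩; exact X.2 i),
    card_inf_torsionBy_le_of_span hR _⟩

/-! ### Reduced echelon matrices -/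

/-- Uniqueness of `π`-adic digits: a combination of the powers of `π` whose coefficients are zero
or units, with zeros from position `b` on, is divisible by `π ^ b` only if it is trivial. -/
theorem eq_zero_of_pow_dvd_sum (hR : IsFiniteChainRing R π q s) {z : Fin s → R} {b : ℕ}
    (hz : ∀ t, π ∣ z t → z t = 0) (hb : ∀ t : Fin s, b ≤ t → z t = 0)
    (hdvd : π ^ b ∣ ∑ t, z t * π ^ (t : ℕ)) (t : Fin s) : z t = 0 := by
  induction t using WellFoundedLT.induction with
  | ind t ih =>
    rcases le_or_gt b t with h | h
    · exact hb t h
    -- Digits are eliminated from the lowest up: the terms below `t` vanish, those above are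
    -- multiples of `π ^ (t + 1)`.
    have h1 : π ^ ((t : ℕ) + 1) ∣ ∑ t, z t * π ^ (t : ℕ) := (pow_dvd_pow π h).trans hdvd
    rw [← Finset.add_sum_erase _ _ (Finset.mem_univ t)] at h1
    have h2 : π ^ ((t : ℕ) + 1) ∣ ∑ t' ∈ Finset.univ.erase t, z t' * π ^ (t' : ℕ) := by
      refine Finset.dvd_sum fun t' ht' => ?_
      rcases lt_trichotomy t' t with h3 | h3 | h3
      · rw [ih t' h3, zero_mul]
        exact dvd_zero _
      · exact absurd h3 (Finset.ne_of_mem_erase ht')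
      · exact Dvd.dvd.mul_left (pow_dvd_pow π h3) _
    obtain ⟨y, hy⟩ := (dvd_add_left h2).1 h1
    have h4 : π ^ (t : ℕ) * (z t - π * y) = 0 := by
      rw [mul_sub, ← mul_assoc, ← pow_succ, ← hy]
      ring
    have h5 := hR.dvd_of_pow_mul_eq_zero t.2 h4
    exact hz t ((dvd_sub_left (dvd_mul_right π y)).1 h5)

/-- The positions of the free digits in a reduced echelon matrix: the digit at the power `π ^ t` in
row `k` and column `j` is free if `k < κ_t ≤ j < μ_t`. -/
def freePositions (n : ℕ) (κ : Fin s → ℕ) (μ : Shape s) :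
    Finset (Σ _ : Fin s, Fin n × Fin (packetLength μ)) :=
  Finset.univ.sigma fun t => (Finset.univ.filter fun k : Fin n => (k : ℕ) < κ t) ×ˢ
    (Finset.univ.filter fun j : Fin (packetLength μ) => κ t ≤ j ∧ (j : ℕ) < μ t)

theorem mem_freePositions {n : ℕ} {κ : Fin s → ℕ} {μ : Shape s} {t : Fin s} {k : Fin n}
    {j : Fin (packetLength μ)} :
    (⟨t, k, j⟩ : Σ _ : Fin s, Fin n × Fin (packetLength μ)) ∈ freePositions n κ μ ↔
      (k : ℕ) < κ t ∧ κ t ≤ j ∧ (j : ℕ) < μ t := by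
  simp [freePositions]

theorem card_freePositions {n : ℕ} {κ : Fin s → ℕ} {μ : Shape s} (hn : ∀ t, κ t ≤ n) :
    (freePositions n κ μ).card = ∑ t, κ t * (μ t - κ t) := by
  rw [freePositions, Finset.card_sigma]
  refine Finset.sum_congr rfl fun t _ => ?_
  rw [Finset.card_product, Fin.card_filter_val_lt, min_eq_right (hn t)]
  congr 1
  rw [← Nat.card_Ico, ← Finset.card_map Fin.valEmbedding]
  congr 1
  ext j
  simp only [Finset.mem_map, Finset.mem_filter, Finset.mem_univ, true_and, Fin.valEmbedding_apply,
    Finset.mem_Ico]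
  constructor
  · rintro ⟨j, hj, rfl⟩
    exact hj
  · intro hj
    exact ⟨⟨j, hj.2.trans_le (le_packetLength μ t)⟩, hj, rfl⟩

open scoped Classical in
/-- The digits of the off-diagonal part of a reduced echelon matrix: representatives of the given
residues at the free positions, and zero elsewhere. -/
noncomputable def echelonDigit {n : ℕ} {κ : Fin s → ℕ} {μ : Shape s}
    (τ : freePositions n κ μ → R ⧸ Ideal.span {π}) (k : Fin n) (j : Fin (packetLength μ))
    (t : Fin s) : R :=
  if h : (⟨t, k, j⟩ : Σ _ : Fin s, Fin n × Fin (packetLength μ)) ∈ freePositions n κ μ then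
    (τ ⟨_, h⟩).out else 0

/-- The off-diagonal part of a reduced echelon matrix. -/
noncomputable def echelonTail {n : ℕ} {κ : Fin s → ℕ} {μ : Shape s}
    (τ : freePositions n κ μ → R ⧸ Ideal.span {π}) :
    Matrix (Fin n) (Fin (packetLength μ)) R :=
  Matrix.of fun k j => ∑ t, echelonDigit τ k j t * π ^ (t : ℕ)

theorem echelonTail_apply {n : ℕ} {κ : Fin s → ℕ} {μ : Shape s}
    (τ : freePositions n κ μ → R ⧸ Ideal.span {π}) (k : Fin n) (j : Fin (packetLength μ)) :
    echelonTail τ k j = ∑ t, echelonDigit τ k j t * π ^ (t : ℕ) := rfl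

/-- The exponent of the pivot in row `k` of a reduced echelon matrix. -/
def pivotExponent (κ : Fin s → ℕ) (k : ℕ) : ℕ := (Finset.univ.filter fun i => κ i ≤ k).card

/-- The reduced echelon matrix with given digits. -/
noncomputable def echelonMatrix {n : ℕ} {κ : Fin s → ℕ} {μ : Shape s}
    (τ : freePositions n κ μ → R ⧸ Ideal.span {π}) :
    Matrix (Fin n) (Fin (packetLength μ)) R :=
  Matrix.of fun k j => (if (k : ℕ) = j then π ^ pivotExponent κ k else 0) + echelonTail τ k j

section Echelon

variable {n : ℕ} {κ : Fin s → ℕ} {μ : Shape s}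

theorem mem_freePositions_of_echelonDigit_ne_zero {τ : freePositions n κ μ → R ⧸ Ideal.span {π}}
    {k : Fin n} {j : Fin (packetLength μ)} {t : Fin s} (h : echelonDigit τ k j t ≠ 0) :
    (k : ℕ) < κ t ∧ κ t ≤ j ∧ (j : ℕ) < μ t := by
  rw [← mem_freePositions]
  by_contra h'
  exact h (dif_neg h')

/-- As `κ ≤ μ`, the pivot exponent is at least that of its coordinate; a free digit at `π ^ t` in
column `j` has `j < μ_t`, so `t` is at least the exponent of column `j`. -/
theorem echelonMatrix_mem_shapeModule (hκ : ∀ t, κ t ≤ μ t)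
    (τ : freePositions n κ μ → R ⧸ Ideal.span {π}) (k : Fin n) :
    echelonMatrix τ k ∈ shapeModule π μ := by
  refine Submodule.mem_pi.2 fun j _ => Ideal.mem_span_singleton.2 (dvd_add ?_ ?_)
  · split_ifs with h
    · refine pow_dvd_pow π (Finset.card_le_card fun i hi => ?_)
      rw [h]
      exact Finset.mem_filter.2 ⟨Finset.mem_univ _, (hκ i).trans (Finset.mem_filter.1 hi).2⟩
    · exact dvd_zero _
  · rw [echelonTail_apply]
    refine Finset.dvd_sum fun t _ => ?_
    by_cases h : echelonDigit τ k j t = 0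
    · rw [h, zero_mul]
      exact dvd_zero _
    · refine Dvd.dvd.mul_left (pow_dvd_pow π (not_lt.1 fun h' => ?_)) _
      have h1 := (lt_card_filter_le_iff μ.monotone t j).1 h'
      have h2 := (mem_freePositions_of_echelonDigit_ne_zero h).2.2
      omega

theorem pow_pivotExponent_dvd_echelonTail (hκ : Monotone κ)
    (τ : freePositions n κ μ → R ⧸ Ideal.span {π}) (k : Fin n) (j : Fin (packetLength μ)) :
    π ^ pivotExponent κ k ∣ echelonTail τ k j := by
  rw [echelonTail_apply]
  refine Finset.dvd_sum fun t _ => ?_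
  by_cases h : echelonDigit τ k j t = 0
  · rw [h, zero_mul]
    exact dvd_zero _
  · refine Dvd.dvd.mul_left (pow_dvd_pow π (not_lt.1 fun h' => ?_)) _
    have h1 := (lt_card_filter_le_iff hκ t k).1 h'
    have h2 := (mem_freePositions_of_echelonDigit_ne_zero h).1
    omega

theorem echelonTail_eq_zero (τ : freePositions n κ μ → R ⧸ Ideal.span {π}) {k : Fin n}
    {j : Fin (packetLength μ)} (hjk : (j : ℕ) ≤ k) : echelonTail τ k j = 0 := by
  rw [echelonTail_apply]
  refine Finset.sum_eq_zero fun t _ => ?_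
  by_cases h : echelonDigit τ k j t = 0
  · rw [h, zero_mul]
  · have := mem_freePositions_of_echelonDigit_ne_zero h
    omega

/-- Free digits in column `j` satisfy `κ_t ≤ j`, so they sit below the power `pivotExponent κ j` and
can be read modulo it. This is why the digits above a pivot are kept reduced. -/
theorem echelonDigit_eq_of_dvd (hR : IsFiniteChainRing R π q s) (hκ : Monotone κ)
    (τ τ' : freePositions n κ μ → R ⧸ Ideal.span {π}) (k : Fin n) (j : Fin (packetLength μ))
    (h : π ^ pivotExponent κ j ∣ echelonTail τ k j - echelonTail τ' k j) :
    echelonDigit τ k j = echelonDigit τ' k j := by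
  have hsum : echelonTail τ k j - echelonTail τ' k j =
      ∑ t, (echelonDigit τ k j t - echelonDigit τ' k j t) * π ^ (t : ℕ) := by
    simp only [echelonTail_apply, sub_mul, Finset.sum_sub_distrib]
  rw [hsum] at h
  funext t
  refine sub_eq_zero.1 (eq_zero_of_pow_dvd_sum hR (b := pivotExponent κ j)
    (z := fun t => echelonDigit τ k j t - echelonDigit τ' k j t) (fun t ht => ?_)
    (fun t ht => ?_) h t)
  · unfold echelonDigit at ht ⊢
    split_ifs at ht ⊢ with hmem
    · have h1 := Ideal.Quotient.eq_zero_iff_mem.2 (Ideal.mem_span_singleton.2 ht)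
      rw [map_sub, Ideal.Quotient.mk_out, Ideal.Quotient.mk_out] at h1
      rw [sub_eq_zero.1 h1, sub_self]
    · exact sub_self 0
  · have hnot : ¬ κ t ≤ j := fun h' => absurd ((lt_card_filter_le_iff hκ t j).2 h') (not_lt.2 ht)
    have hzero : ∀ τ : freePositions n κ μ → R ⧸ Ideal.span {π}, echelonDigit τ k j t = 0 := by
      intro τ
      by_contra h'
      exact hnot (mem_freePositions_of_echelonDigit_ne_zero h').2.1
    simp only [hzero, sub_self]

/-- Distinct digits give reduced echelon matrices with distinct row spans. -/
theorem rowSpan_echelonMatrix_injective (hR : IsFiniteChainRing R π q s) (hκ : Monotone κ) :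
    Function.Injective fun τ : freePositions n κ μ → R ⧸ Ideal.span {π} =>
      rowSpan (echelonMatrix τ) := by
  intro τ τ' hspan
  have hdigit : ∀ (k : Fin n) (j : Fin (packetLength μ)),
      echelonDigit τ k j = echelonDigit τ' k j := by
    intro k
    obtain ⟨c, hc⟩ := mem_rowSpan_iff.1
      ((show rowSpan (echelonMatrix τ') ≤ rowSpan (echelonMatrix τ) from hspan.ge)
        (Submodule.subset_span ⟨k, rfl⟩))
    -- Induction on columns. The coefficient of row `j` is only determined up to the annihilator of
    -- its pivot, which suffices because the pivot divides the whole tail of its row.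
    suffices h : ∀ j : ℕ, ∀ hj : j < packetLength μ,
        echelonDigit τ k ⟨j, hj⟩ = echelonDigit τ' k ⟨j, hj⟩ ∧
        ∀ hjn : j < n, c ⟨j, hjn⟩ * π ^ pivotExponent κ j =
          if j = k then π ^ pivotExponent κ j else 0 from fun j => (h j j.2).1
    intro j
    induction j using Nat.strong_induction_on with
    | _ j ih =>
    intro hj
    -- Rows `l < j` contribute as if `c` were the unit vector at `k`, by induction; rows `l ≥ j`
    -- have no tail in column `j`.
    have htail : ∑ l, c l * echelonTail τ l ⟨j, hj⟩ = echelonTail τ k ⟨j, hj⟩ := by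
      have hterm : ∀ l, c l * echelonTail τ l ⟨j, hj⟩ =
          if l = k then echelonTail τ l ⟨j, hj⟩ else 0 := by
        intro l
        rcases lt_or_ge (l : ℕ) j with hl | hl
        · obtain ⟨y, hy⟩ := pow_pivotExponent_dvd_echelonTail hκ τ l ⟨j, hj⟩
          have h1 := (ih l hl (hl.trans hj)).2 l.2
          rw [hy, ← mul_assoc, h1]
          simp only [Fin.val_inj]
          split_ifs <;> simp
        · rw [echelonTail_eq_zero τ (j := ⟨j, hj⟩) hl]
          simp
      rw [Finset.sum_congr rfl fun l _ => hterm l]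
      simp
    set D := ∑ l, c l * (if (l : ℕ) = j then π ^ pivotExponent κ l else 0) with hD
    have hDn : ∀ hjn : j < n, D = c ⟨j, hjn⟩ * π ^ pivotExponent κ j := by
      intro hjn
      rw [hD, Finset.sum_eq_single ⟨j, hjn⟩]
      · simp
      · intro l _ hl
        rw [if_neg fun h => hl (Fin.ext h), mul_zero]
      · simp
    have hDdvd : π ^ pivotExponent κ j ∣ D := by
      refine Finset.dvd_sum fun l _ => Dvd.dvd.mul_left ?_ _
      split_ifs with h
      · rw [h]
      · exact dvd_zero _
    have hcol : D + echelonTail τ k ⟨j, hj⟩ =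
        (if (k : ℕ) = j then π ^ pivotExponent κ k else 0) + echelonTail τ' k ⟨j, hj⟩ := by
      rw [← htail, hD, ← Finset.sum_add_distrib]
      have h1 := congrFun hc ⟨j, hj⟩
      simp only [← mul_add]
      exact h1
    have hdig : echelonDigit τ k ⟨j, hj⟩ = echelonDigit τ' k ⟨j, hj⟩ := by
      refine echelonDigit_eq_of_dvd hR hκ τ τ' k ⟨j, hj⟩ ?_
      -- Off the diagonal the two tails differ by `D`, a multiple of the pivot of row `j` (zero if
      -- there is no such row).
      rcases eq_or_ne (k : ℕ) j with h | h
      · rw [echelonTail_eq_zero τ (j := ⟨j, hj⟩) h.ge, echelonTail_eq_zero τ' (j := ⟨j, hj⟩) h.ge,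
          sub_zero]
        exact dvd_zero _
      · rw [if_neg h, zero_add] at hcol
        rw [← dvd_neg]
        have : -(echelonTail τ k ⟨j, hj⟩ - echelonTail τ' k ⟨j, hj⟩) = D := by
          rw [← hcol]
          ring
        rwa [this]
    refine ⟨hdig, fun hjn => ?_⟩
    have htaileq : echelonTail τ k ⟨j, hj⟩ = echelonTail τ' k ⟨j, hj⟩ := by
      simp only [echelonTail_apply, hdig]
    rw [htaileq] at hcol
    rw [← hDn hjn, add_right_cancel hcol]
    rcases eq_or_ne (k : ℕ) j with h | h
    · rw [if_pos h, if_pos h.symm, h]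
    · rw [if_neg h, if_neg h.symm]
  funext ⟨⟨t, k, j⟩, hmem⟩
  have h1 := congrFun (hdigit k j) t
  unfold echelonDigit at h1
  rw [dif_pos hmem, dif_pos hmem] at h1
  have h2 := congrArg (Ideal.Quotient.mk (Ideal.span {π})) h1
  rwa [Ideal.Quotient.mk_out, Ideal.Quotient.mk_out] at h2

end Echelon

theorem kappa_monotone (n : ℕ) (μ : Shape s) : Monotone (kappa n μ) := fun _ _ h =>
  min_le_min_left n (Nat.div_le_div_right (μ.monotone h))

theorem kappa_le (n : ℕ) (μ : Shape s) (i : Fin s) : kappa n μ i ≤ μ i :=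
  (min_le_right _ _).trans (Nat.div_le_self _ _)

/-- The number of row spans is at least the main term. -/
theorem le_ncard_range_rowSpan [Finite R] (hR : IsFiniteChainRing R π q s) (n : ℕ) (μ : Shape s) :
    q ^ ∑ i, kappa n μ i * (μ i - kappa n μ i) ≤
      (Set.range fun X : RowMatrix π n μ => rowSpan X.1).ncard := by
  rw [← card_freePositions (n := n) (κ := kappa n μ) fun t => min_le_left _ _]
  have hcard : Nat.card (freePositions n (kappa n μ) μ → R ⧸ Ideal.span {π}) =
      q ^ (freePositions n (kappa n μ) μ).card := by
    rw [Nat.card_fun, hR.residue_card, Nat.card_eq_fintype_card, Fintype.card_coe]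
  rw [← hcard]
  exact Nat.card_le_card_of_injective
    (fun τ => (⟨rowSpan (echelonMatrix τ),
      ⟨⟨echelonMatrix τ, echelonMatrix_mem_shapeModule (kappa_le n μ) τ⟩, rfl⟩⟩ :
      Set.range fun X : RowMatrix π n μ => rowSpan X.1))
    fun τ τ' h => rowSpan_echelonMatrix_injective hR (kappa_monotone n μ) (congrArg Subtype.val h)

end RowSpans

end SubmoduleCounting

/-! ### The capacity bounds and the asymptotic capacity -/

section Bounds

variable {R : Type*} [CommRing R] [Finite R] {π : R} {q s : ℕ}

theorem cast_sum_kappa_mul (n : ℕ) (μ : Shape s) :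
    ((∑ i, kappa n μ i * (μ i - kappa n μ i) : ℕ) : ℝ) =
      ∑ i, (kappa n μ i : ℝ) * ((μ i : ℝ) - (kappa n μ i : ℝ)) := by
  rw [Nat.cast_sum]
  refine Finset.sum_congr rfl fun i _ => ?_
  rw [Nat.cast_mul, Nat.cast_sub (kappa_le n μ i)]

theorem le_mmcCapacity (hR : IsFiniteChainRing R π q s) {n N : ℕ} (hn : n ≤ N) (μ : Shape s) :
    ∑ i, (kappa n μ i : ℝ) * ((μ i : ℝ) - (kappa n μ i : ℝ)) ≤ mmcCapacity π q n N μ := by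
  have hq : (1 : ℝ) < q := by exact_mod_cast hR.one_lt_residue_card
  rw [mmcCapacity_eq hR hn, ← cast_sum_kappa_mul]
  have h := le_ncard_range_rowSpan hR n μ
  set L := (Set.range fun X : RowMatrix π n μ => rowSpan X.1).ncard
  have hL : (q : ℝ) ^ (∑ i, kappa n μ i * (μ i - kappa n μ i)) ≤ L := by exact_mod_cast h
  have hpos : (0 : ℝ) < (q : ℝ) ^ (∑ i, kappa n μ i * (μ i - kappa n μ i)) := by positivity
  rw [Real.le_logb_iff_rpow_le hq (hpos.trans_le hL), Real.rpow_natCast]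
  exact hL

theorem mmcCapacity_le (hR : IsFiniteChainRing R π q s) {n N : ℕ} (hn : n ≤ N) (μ : Shape s) :
    mmcCapacity π q n N μ ≤
      ∑ i, (kappa n μ i : ℝ) * ((μ i : ℝ) - (kappa n μ i : ℝ)) +
        Real.logb (q : ℝ) ((4 : ℝ) ^ s * ((n + s).choose s : ℝ)) := by
  have hq : (1 : ℝ) < q := by exact_mod_cast hR.one_lt_residue_card
  rw [mmcCapacity_eq hR hn, ← cast_sum_kappa_mul]
  have h := ncard_range_rowSpan_le hR n μ
  have h0 := le_ncard_range_rowSpan hR n μ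
  set L := (Set.range fun X : RowMatrix π n μ => rowSpan X.1).ncard
  set E := ∑ i, kappa n μ i * (μ i - kappa n μ i)
  have hL : (L : ℝ) ≤ (4 : ℝ) ^ s * ((n + s).choose s : ℝ) * (q : ℝ) ^ E := by exact_mod_cast h
  have hE : (q : ℝ) ^ E ≤ L := by exact_mod_cast h0
  have hpos : (0 : ℝ) < (q : ℝ) ^ E := by positivity
  have hchoose : (0 : ℝ) < ((n + s).choose s : ℝ) := by
    exact_mod_cast Nat.choose_pos (Nat.le_add_left s n)
  have hlog : Real.logb q ((q : ℝ) ^ E) = E := by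
    rw [← Real.rpow_natCast, Real.logb_rpow (by linarith) hq.ne']
  calc Real.logb q L ≤ Real.logb q ((4 : ℝ) ^ s * ((n + s).choose s : ℝ) * (q : ℝ) ^ E) :=
        Real.logb_le_logb_of_le hq (hpos.trans_le hE) hL
    _ = E + Real.logb (q : ℝ) ((4 : ℝ) ^ s * ((n + s).choose s : ℝ)) := by
        rw [Real.logb_mul (by positivity) (by positivity), hlog, add_comm]

end Bounds

/-! ### The error term and the limit -/

/-- Bounding the binomial coefficient by `2 ^ (n + s)` is crude, but a bound linear in `n` is
negligible against `m²`. -/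
theorem logb_four_pow_mul_choose_le {b : ℝ} (hb : 1 < b) (n s : ℕ) :
    Real.logb b ((4 : ℝ) ^ s * ((n + s).choose s : ℝ)) ≤ (3 * s + n) * Real.logb b 2 := by
  have hchoose : (0 : ℝ) < ((n + s).choose s : ℝ) := by
    exact_mod_cast Nat.choose_pos (Nat.le_add_left s n)
  have h1 : ((n + s).choose s : ℝ) ≤ 2 ^ (n + s) := by
    exact_mod_cast Nat.choose_le_two_pow (n + s) s
  calc Real.logb b ((4 : ℝ) ^ s * ((n + s).choose s : ℝ)) ≤ Real.logb b (2 ^ (3 * s + n)) := by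
        refine Real.logb_le_logb_of_le hb (by positivity) ?_
        calc (4 : ℝ) ^ s * ((n + s).choose s : ℝ) ≤ 4 ^ s * 2 ^ (n + s) := by gcongr
          _ = 2 ^ (3 * s + n) := by
            rw [show (4 : ℝ) = 2 ^ 2 by norm_num, ← pow_mul, ← pow_add]
            ring_nf
    _ = (3 * s + n) * Real.logb b 2 := by
        rw [← Real.rpow_natCast, Real.logb_rpow_eq_mul_logb_of_pos (by norm_num)]
        push_cast
        ring

theorem logb_four_pow_mul_choose_nonneg {b : ℝ} (hb : 1 < b) (n s : ℕ) :
    0 ≤ Real.logb b ((4 : ℝ) ^ s * ((n + s).choose s : ℝ)) := by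
  refine Real.logb_nonneg hb ?_
  have h1 : (1 : ℝ) ≤ ((n + s).choose s : ℝ) := by
    exact_mod_cast Nat.choose_pos (Nat.le_add_left s n)
  exact one_le_mul_of_one_le_of_one_le (one_le_pow₀ (by norm_num)) h1

section Asymptotics

variable {s : ℕ} {nbar : ℝ} {μbar : Fin s → ℝ} {n : ℕ → ℕ} {μ : ℕ → Shape s}

/-- Rounding down `μ_i / 2` costs at most `1`, that is at most `1 / m` after division. -/
theorem tendsto_kappa_div_packetLength
    (hm : Tendsto (fun k => packetLength (μ k)) atTop atTop)
    (hn : ∀ k, (n k : ℝ) = nbar * (packetLength (μ k) : ℝ))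
    (hμ : ∀ k i, (μ k i : ℝ) = μbar i * (packetLength (μ k) : ℝ)) (i : Fin s) :
    Tendsto (fun k => (kappa (n k) (μ k) i : ℝ) / (packetLength (μ k) : ℝ)) atTop
      (𝓝 (min nbar (μbar i / 2))) := by
  have hm' : Tendsto (fun k => (packetLength (μ k) : ℝ)) atTop atTop :=
    tendsto_natCast_atTop_atTop.comp hm
  have hmin : ∀ k, min nbar (μbar i / 2) * (packetLength (μ k) : ℝ) =
      min (n k : ℝ) ((μ k i : ℝ) / 2) := by
    intro k
    rw [min_mul_of_nonneg _ _ (Nat.cast_nonneg _), ← hn, div_mul_eq_mul_div, ← hμ]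
  have hlow : Tendsto (fun k => min nbar (μbar i / 2) - (packetLength (μ k) : ℝ)⁻¹) atTop
      (𝓝 (min nbar (μbar i / 2))) := by
    simpa using tendsto_const_nhds.sub (tendsto_inv_atTop_zero.comp hm')
  refine tendsto_of_tendsto_of_tendsto_of_le_of_le' hlow tendsto_const_nhds ?_ ?_
  · filter_upwards [hm'.eventually_gt_atTop 0] with k hk
    rw [le_div_iff₀ hk, sub_mul, hmin, inv_mul_cancel₀ hk.ne', kappa, Nat.cast_min]
    have h1 : ((μ k i : ℝ) / 2) - 1 ≤ ((μ k i / 2 : ℕ) : ℝ) := by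
      have h2 : μ k i ≤ 2 * (μ k i / 2) + 2 := by omega
      have h3 : (μ k i : ℝ) ≤ 2 * ((μ k i / 2 : ℕ) : ℝ) + 2 := by exact_mod_cast h2
      linarith
    refine le_min ?_ ?_
    · have := min_le_left (n k : ℝ) ((μ k i : ℝ) / 2)
      linarith
    · have := min_le_right (n k : ℝ) ((μ k i : ℝ) / 2)
      linarith
  · filter_upwards [hm'.eventually_gt_atTop 0] with k hk
    rw [div_le_iff₀ hk, hmin, kappa, Nat.cast_min]
    exact min_le_min_left _ Nat.cast_div_le

/-- Both capacity bounds, divided by `m²`, tend to the same sum, and `n * |μ|` is exactly `m²` times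
the constant `nbar * ∑ i, μbar i`. -/
theorem tendsto_mmcCapacity_div {R : Type*} [CommRing R] [Finite R] {π : R} {q : ℕ}
    (hR : IsFiniteChainRing R π q s) {N : ℕ → ℕ} (hN : ∀ k, n k ≤ N k)
    (hm : Tendsto (fun k => packetLength (μ k)) atTop atTop)
    (hn : ∀ k, (n k : ℝ) = nbar * (packetLength (μ k) : ℝ))
    (hμ : ∀ k i, (μ k i : ℝ) = μbar i * (packetLength (μ k) : ℝ)) :
    Tendsto (fun k => mmcCapacity π q (n k) (N k) (μ k) / ((n k : ℝ) * ((μ k).size : ℝ))) atTop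
      (𝓝 ((∑ i, min nbar (μbar i / 2) * (μbar i - min nbar (μbar i / 2))) /
        (nbar * ∑ i, μbar i))) := by
  have hq : (1 : ℝ) < q := by exact_mod_cast hR.one_lt_residue_card
  have hm' : Tendsto (fun k => (packetLength (μ k) : ℝ)) atTop atTop :=
    tendsto_natCast_atTop_atTop.comp hm
  have hinv : Tendsto (fun k => (packetLength (μ k) : ℝ)⁻¹) atTop (𝓝 0) :=
    tendsto_inv_atTop_zero.comp hm'
  have hmain : Tendsto (fun k => (∑ i, (kappa (n k) (μ k) i : ℝ) *
      ((μ k i : ℝ) - (kappa (n k) (μ k) i : ℝ))) / (packetLength (μ k) : ℝ) ^ 2) atTop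
      (𝓝 (∑ i, min nbar (μbar i / 2) * (μbar i - min nbar (μbar i / 2)))) := by
    refine (tendsto_finsetSum Finset.univ fun i _ =>
      (tendsto_kappa_div_packetLength hm hn hμ i).mul
        (tendsto_const_nhds.sub (tendsto_kappa_div_packetLength hm hn hμ i))).congr' ?_
    filter_upwards [hm'.eventually_gt_atTop 0] with k hk
    rw [Finset.sum_div]
    refine Finset.sum_congr rfl fun i _ => ?_
    rw [hμ]
    field_simp
  have herror : Tendsto (fun k => Real.logb (q : ℝ) ((4 : ℝ) ^ s * ((n k + s).choose s : ℝ)) /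
      (packetLength (μ k) : ℝ) ^ 2) atTop (𝓝 0) := by
    have hbound : Tendsto (fun k => (3 * s * (packetLength (μ k) : ℝ)⁻¹ + nbar) *
        (packetLength (μ k) : ℝ)⁻¹ * Real.logb q 2) atTop (𝓝 0) := by
      simpa using (((hinv.const_mul (3 * s : ℝ)).add_const nbar).mul hinv).mul_const
        (Real.logb q 2)
    refine squeeze_zero' (Eventually.of_forall fun k =>
      div_nonneg (logb_four_pow_mul_choose_nonneg hq (n k) s) (sq_nonneg _)) ?_ hbound
    filter_upwards [hm'.eventually_gt_atTop 0] with k hk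
    rw [div_le_iff₀ (by positivity)]
    refine (logb_four_pow_mul_choose_le hq (n k) s).trans (le_of_eq ?_)
    rw [hn]
    field_simp
  have hcap : Tendsto (fun k => mmcCapacity π q (n k) (N k) (μ k) /
      (packetLength (μ k) : ℝ) ^ 2) atTop
      (𝓝 (∑ i, min nbar (μbar i / 2) * (μbar i - min nbar (μbar i / 2)))) := by
    refine tendsto_of_tendsto_of_tendsto_of_le_of_le hmain
      (by simpa using hmain.add herror) (fun k => ?_) fun k => ?_
    · exact div_le_div_of_nonneg_right (le_mmcCapacity hR (hN k) (μ k)) (sq_nonneg _)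
    · dsimp only
      rw [← add_div]
      exact div_le_div_of_nonneg_right (mmcCapacity_le hR (hN k) (μ k)) (sq_nonneg _)
  refine (hcap.div_const (nbar * ∑ i, μbar i)).congr fun k => ?_
  have hsize : ((μ k).size : ℝ) = (∑ i, μbar i) * (packetLength (μ k) : ℝ) := by
    rw [Shape.size, Nat.cast_sum, Finset.sum_mul]
    exact Finset.sum_congr rfl fun i _ => hμ k i
  rw [div_div, hn, hsize]
  congr 1
  ring

end Asymptotics

/-- First part: the maximum defining the capacity exists, and the capacity satisfies the two
bounds. Second part: the asymptotic capacity, along any sequence of parameters whose packet length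
tends to infinity while `n̄ = n / m` and `μ̄ = μ / m` are fixed. -/
theorem mainTheorem7 {R : Type*} [CommRing R] [Finite R] (π : R) (q s : ℕ)
    (hR : IsFiniteChainRing R π q s) :
    (∀ (n N : ℕ) (μ : Shape s), n ≤ N →
      IsGreatest (mmcInfos π q n N μ) (mmcCapacity π q n N μ) ∧
      ∑ i, (kappa n μ i : ℝ) * ((μ i : ℝ) - (kappa n μ i : ℝ)) ≤ mmcCapacity π q n N μ ∧
      mmcCapacity π q n N μ ≤
        ∑ i, (kappa n μ i : ℝ) * ((μ i : ℝ) - (kappa n μ i : ℝ)) +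
          Real.logb (q : ℝ) ((4 : ℝ) ^ s * ((n + s).choose s : ℝ))) ∧
    (∀ (nbar : ℝ) (μbar : Fin s → ℝ) (n N : ℕ → ℕ) (μ : ℕ → Shape s),
      0 < nbar →
      (∀ k, n k ≤ N k) →
      Tendsto (fun k => packetLength (μ k)) atTop atTop →
      (∀ k, (n k : ℝ) = nbar * (packetLength (μ k) : ℝ)) →
      (∀ k i, (μ k i : ℝ) = μbar i * (packetLength (μ k) : ℝ)) →
      ∀ κbar : Fin s → ℝ, (∀ i, κbar i = min nbar (μbar i / 2)) →
        (∀ i, Tendsto (fun k => (kappa (n k) (μ k) i : ℝ) / (packetLength (μ k) : ℝ)) atTop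
          (𝓝 (κbar i))) ∧
        Tendsto
          (fun k => mmcCapacity π q (n k) (N k) (μ k) / ((n k : ℝ) * ((μ k).size : ℝ))) atTop
          (𝓝 ((∑ i, κbar i * (μbar i - κbar i)) / (nbar * ∑ i, μbar i)))) := by
  refine ⟨fun n N μ hn => ⟨?_, le_mmcCapacity hR hn μ, mmcCapacity_le hR hn μ⟩, ?_⟩
  · rw [mmcCapacity_eq hR hn]
    exact isGreatest_mmcInfos hR hn μ
  · intro nbar μbar n N μ _ hN hm hn hμ κbar hκ
    obtain rfl : κbar = fun i => min nbar (μbar i / 2) := funext hκ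
    exact ⟨tendsto_kappa_div_packetLength hm hn hμ, tendsto_mmcCapacity_div hR hN hm hn hμ⟩
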